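/- Setting. Let $P=\mathsf P_{X,Y}$ be a probability measure on a product $\mathcal X\times\mathcal Y$ of measurable spaces, with marginals $\mathsf P_X,\mathsf P_Y$, and let $m\le n$. Let $\mathbb P_0=\mathsf P_X^{\otimes n}\otimes\mathsf P_Y^{\otimes m}$ on $\mathcal X^n\times\mathcal Y^m$. Let $\mathbb P_1$ be the law of $(X_1,\dots,X_n,Y_1,\dots,Y_m)$ when, conditionally on a uniformly random injection $\pi:[m]\to[n]$, the pairs $(X_{\pi(i)},Y_i)$, $i\in[m]$, are i.i.d. with law $\mathsf P_{X,Y}$ and the $X_j$, $j\notin\pi([m])$, are i.i.d. with law $\mathsf P_X$ and independent of these pairs. Write $\mathbf L=d\mathbb P_1/d\mathbb P_0$ and $\mathbb E_0$ for the expectation under $\mathbb P_0$. Let $$I_{\chi^2}(X;Y)=\chi^2(\mathsf P_{X,Y}\,\|\,\mathsf P_X\otimes\mathsf P_Y),\qquad \rho(X;Y)=\sup\mathbb E[g(X)h(Y)],$$ where $\chi^2(P\|Q)=\int(\tfrac{dP}{dQ}-1)^2dQ$ if $P\ll Q$ and $\infty$ otherwise, and the supremum is over $g,h$ with $\mathbb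 E g(X)=\mathbb E h(Y)=0$ and $\mathbb E g(X)^2=\mathbb E h(Y)^2=1$ (with $\rho(X;Y)=0$ if there are none). If $I_{\chi^2}(X;Y)<\infty$, let $1=\lambda_0\ge\lambda_1\ge\cdots\ge0$ be the singular values, with multiplicity and continued by zeros if there are only finitely many, of the Hilbert–Schmidt operator $L_2(\mathsf P_Y)\to L_2(\mathsf P_X)$, $h\mapsto\int L(\cdot,y)h(y)\,d\mathsf P_Y(y)$, where $L=d\mathsf P_{X,Y}/d(\mathsf P_X\otimes\mathsf P_Y)$; equivalently, of $h\mapsto\mathbb E[h(Y)\mid X=\cdot\,]$. In the asymptotic statements $n\to\infty$, and $m=m_n\le n$, $\mathcal X$, $\mathcal Y$ and $\mathsf P_{X,Y}$ may all depend on $n$. Strong detection is possible if there are measurable tests (rejection regions) $A_n\subseteq\mathcal X^n\times\mathcal Y^m$ with $\mathbb P_0(A_n)\to0$ and $\mathbb P_1(A_n^c)\to0$, and impossible otherwise. Statement. Let $c,c_1\in(0,1)$ and $C>0$ be constants. (1) If $I_{\chi^2}(X;Y)<\infty$ and $m\le(1-c)n$, then $$\mathbb E_0\mathbf L^2\le\prod_{k=0}^\infty\frac1{1-\frac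 mn\lambda_k^2},$$ where the product converges. (2) If $m=(1-o(1))n$ and, for all large $n$, $I_{\chi^2}(X;Y)<\infty$, $\lambda_1\le1-c_1$ and $\sum_{k\ge1}\lambda_k^2\le C$, then, for all large $n$, $\mathbb E_0\mathbf L^2$ is finite and the product below converges, and $$\Bigl|\mathbb E_0\mathbf L^2-\prod_{k=1}^\infty\frac1{1-\lambda_k^2}\Bigr|\to0\qquad(n\to\infty).$$ (3) If, for all large $n$, $m\le(1-c)n$ and $I_{\chi^2}(X;Y)\le C\frac nm$, then $\mathbb E_0\mathbf L^2\le K$ for all large $n$, with a constant $K$ that depends only on $c$ and $C$, and strong detection is impossible. (4) If $m=(1-o(1))n$ and, for all large $n$, $\rho(X;Y)\le1-c_1$ and $I_{\chi^2}(X;Y)\le C$, then $\mathbb E_0\mathbf L^2\le K$ for all large $n$, with a constant $K$ that depends only on $c_1$ and $C$, and strong detection is impossible. -/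

import Mathlib

open MeasureTheory Filter Topology Set
open scoped ENNReal NNReal

universe u v

namespace BrokenSample

noncomputable section

/-- The `χ²`-divergence `χ²(P‖Q) = ∫ (dP/dQ - 1)² dQ` if `P ≪ Q`, and `∞` otherwise. -/
def chiSq {Ω : Type*} [MeasurableSpace Ω] (P Q : Measure Ω) : ℝ≥0∞ :=
  open Classical in
  if P ≪ Q then ∫⁻ ω, ENNReal.ofReal (((P.rnDeriv Q ω).toReal - 1) ^ 2) ∂Q else ∞

section Pair

variable {X : Type u} {Y : Type v} [MeasurableSpace X] [MeasurableSpace Y]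

/-- The `χ²`-information of a pair with joint law `P` and marginals `P.fst`, `P.snd`. -/
def chiSqInfo (P : Measure (X × Y)) : ℝ≥0∞ := chiSq P (P.fst.prod P.snd)

/-- The Hirschfeld–Gebelein–Rényi maximal correlation (`0` if no admissible pair `g, h` exists,
that is, if one of the two `σ`-algebras is trivial up to null sets). -/
def maximalCorrelation (P : Measure (X × Y)) : ℝ :=
  sSup {r : ℝ | ∃ (g : X → ℝ) (h : Y → ℝ), Measurable g ∧ Measurable h ∧
    MemLp g 2 P.fst ∧ MemLp h 2 P.snd ∧
    ∫ x, g x ∂P.fst = 0 ∧ ∫ y, h y ∂P.snd = 0 ∧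
    ∫ x, g x ^ 2 ∂P.fst = 1 ∧ ∫ y, h y ^ 2 ∂P.snd = 1 ∧
    r = ∫ p, g p.1 * h p.2 ∂P}

/-- The embedding `g ↦ g(X)` of `L²(P_X)` into `L²(P)`. -/
def liftFst (P : Measure (X × Y)) : Lp ℝ 2 P.fst →L[ℝ] Lp ℝ 2 P :=
  (Lp.compMeasurePreservingₗᵢ (μ := P) (μb := P.fst) (E := ℝ) (p := 2) ℝ Prod.fst
    ⟨measurable_fst, rfl⟩).toContinuousLinearMap

/-- The embedding `h ↦ h(Y)` of `L²(P_Y)` into `L²(P)`. -/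
def liftSnd (P : Measure (X × Y)) : Lp ℝ 2 P.snd →L[ℝ] Lp ℝ 2 P :=
  (Lp.compMeasurePreservingₗᵢ (μ := P) (μb := P.snd) (E := ℝ) (p := 2) ℝ Prod.snd
    ⟨measurable_snd, rfl⟩).toContinuousLinearMap

/-- The conditional mean operator `h ↦ 𝔼[h(Y) | X = ·]` from `L²(P_Y)` to `L²(P_X)`, that is, the
operator with `⟪g, 𝓛 h⟫ = 𝔼[g(X) h(Y)]`. By `likelihoodOp_ae_eq` it is the integral operator whose
kernel is the likelihood ratio `dP / d(P_X ⊗ P_Y)`, whenever the latter exists. -/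
def likelihoodOp (P : Measure (X × Y)) : Lp ℝ 2 P.snd →L[ℝ] Lp ℝ 2 P.fst :=
  (ContinuousLinearMap.adjoint (liftFst P)).comp (liftSnd P)

theorem likelihoodOp_ae_eq (P : Measure (X × Y)) [IsProbabilityMeasure P]
    (hP : P ≪ P.fst.prod P.snd) (h : Lp ℝ 2 P.snd) :
    (likelihoodOp P h : X → ℝ) =ᵐ[P.fst]
      fun x => ∫ y, (P.rnDeriv (P.fst.prod P.snd) (x, y)).toReal * h y ∂P.snd := by
  have hS : (liftSnd P h : X × Y → ℝ) =ᵐ[P] fun p => h p.2 :=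
    Lp.coeFn_compMeasurePreserving h ⟨measurable_snd, rfl⟩
  have hint : Integrable (fun p : X × Y => h p.2) P :=
    ((Lp.memLp (liftSnd P h)).integrable one_le_two).congr hS
  have hint' : Integrable (fun p : X × Y =>
      (P.rnDeriv (P.fst.prod P.snd) p).toReal * h p.2) (P.fst.prod P.snd) :=
    (integrable_rnDeriv_smul_iff hP).2 hint
  refine Integrable.ae_eq_of_forall_setIntegral_eq _ _
    ((Lp.memLp _).integrable one_le_two) hint'.integral_prod_left ?_
  intro s hs _
  have hfin : P.fst s ≠ ∞ := measure_ne_top _ _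
  have h1 : ∫ x in s, (likelihoodOp P h : X → ℝ) x ∂P.fst
      = inner ℝ (indicatorConstLp 2 hs hfin (1 : ℝ)) (likelihoodOp P h) :=
    (L2.inner_indicatorConstLp_one hs hfin _).symm
  rw [h1, likelihoodOp, ContinuousLinearMap.comp_apply, ContinuousLinearMap.adjoint_inner_right]
  have hF : (liftFst P (indicatorConstLp 2 hs hfin (1 : ℝ)) : X × Y → ℝ) =ᵐ[P]
      fun p => s.indicator (fun _ => (1 : ℝ)) p.1 := by
    refine (Lp.coeFn_compMeasurePreserving _ ⟨measurable_fst, rfl⟩).trans ?_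
    exact (⟨measurable_fst, rfl⟩ : MeasurePreserving Prod.fst P P.fst).quasiMeasurePreserving.ae_eq_comp
      (indicatorConstLp_coeFn (p := 2) (hs := hs) (hμs := hfin) (c := (1 : ℝ)))
  rw [L2.inner_def]
  have h2 : ∫ p, inner ℝ ((liftFst P (indicatorConstLp 2 hs hfin (1 : ℝ)) : X × Y → ℝ) p)
      ((liftSnd P h : X × Y → ℝ) p) ∂P = ∫ p in s ×ˢ univ, h p.2 ∂P := by
    rw [← integral_indicator (hs.prod MeasurableSet.univ)]
    refine integral_congr_ae ?_
    filter_upwards [hF, hS] with p hp1 hp2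
    rw [hp1, hp2]
    by_cases hps : p.1 ∈ s <;> simp [indicator, hps]
  rw [h2, ← setIntegral_toReal_rnDeriv_mul hP (hs.prod MeasurableSet.univ),
    setIntegral_prod _ hint'.integrableOn, Measure.restrict_univ]

end Pair

/-- The `k`-th singular value (`k = 0, 1, …`) of a compact operator `T`: the square root of the
`k`-th largest eigenvalue of `T†T`, eigenvalues being counted with multiplicity, and `0` if `T†T`
has at most `k` positive eigenvalues. It is the largest `s > 0` such that the eigenvalues `≥ s²`
have total multiplicity at least `k + 1`. -/
def singularValue {E : Type u} {F : Type v} [NormedAddCommGroup E] [InnerProductSpace ℝ E]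
    [CompleteSpace E] [NormedAddCommGroup F] [InnerProductSpace ℝ F] [CompleteSpace F]
    (T : E →L[ℝ] F) (k : ℕ) : ℝ :=
  sSup ({0} ∪ {s : ℝ | 0 < s ∧ ((k + 1 : ℕ) : Cardinal) ≤
    Module.rank ℝ (⨆ (μ : ℝ) (_ : s ^ 2 ≤ μ), Module.End.eigenspace
      (((ContinuousLinearMap.adjoint T).comp T : E →L[ℝ] E) : E →ₗ[ℝ] E) μ : Submodule ℝ E)})

section Model

variable {X : Type u} {Y : Type v} [MeasurableSpace X] [MeasurableSpace Y]

/-- The singular values `lam P 0 ≥ lam P 1 ≥ …` of the likelihood ratio operator. They are used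
only if the `χ²`-information of `P` is finite, in which case the operator is Hilbert–Schmidt. -/
def lam (P : Measure (X × Y)) (k : ℕ) : ℝ := singularValue (likelihoodOp P) k

/-- The law of the data under the null hypothesis. -/
def nullLaw (P : Measure (X × Y)) (n m : ℕ) : Measure ((Fin n → X) × (Fin m → Y)) :=
  (Measure.pi fun _ : Fin n => P.fst).prod (Measure.pi fun _ : Fin m => P.snd)

/-- Turns pairs `w.1 i = (a i, b i)` and an independent sample `w.2` into data: `X_{π i} = a i`,
`Y_i = b i`, and `X_j = w.2 j` for `j` outside the range of `π`. -/
def assemble {n m : ℕ} (π : Fin m ↪ Fin n) (w : (Fin m → X × Y) × (Fin n → X)) :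
    (Fin n → X) × (Fin m → Y) :=
  (Function.extend π (fun i => (w.1 i).1) w.2, fun i => (w.1 i).2)

theorem measurable_assemble {n m : ℕ} (π : Fin m ↪ Fin n) :
    Measurable (assemble (X := X) (Y := Y) π) := by
  refine Measurable.prodMk (measurable_pi_lambda _ fun j => ?_) (by fun_prop)
  by_cases hj : ∃ i, π i = j
  · obtain ⟨i, rfl⟩ := hj
    simp only [π.injective.extend_apply]
    fun_prop
  · simp only [Function.extend_apply' _ _ _ hj]
    fun_prop

/-- The law of the data under the alternative, conditional on the injection `π`: the pairs
`(X_{π i}, Y_i)` are i.i.d. with law `P` and the `X_j` with `j` outside the range of `π` are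
i.i.d. with law `P_X`, independent of those pairs. (The coordinates of the second sample that
belong to the range of `π` are discarded by `assemble`.) -/
def altLawGiven (P : Measure (X × Y)) {n m : ℕ} (π : Fin m ↪ Fin n) :
    Measure ((Fin n → X) × (Fin m → Y)) :=
  ((Measure.pi fun _ : Fin m => P).prod (Measure.pi fun _ : Fin n => P.fst)).map (assemble π)

/-- The law of the data under the alternative: `π` is uniform over the injections `[m] → [n]`. -/
def altLaw (P : Measure (X × Y)) (n m : ℕ) : Measure ((Fin n → X) × (Fin m → Y)) :=
  (Fintype.card (Fin m ↪ Fin n) : ℝ≥0∞)⁻¹ • ∑ π : Fin m ↪ Fin n, altLawGiven P π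

/-- `𝔼₀ 𝐋²`, the second moment under the null of the likelihood ratio `𝐋 = dℙ₁/dℙ₀`. -/
def secondMoment (P : Measure (X × Y)) (n m : ℕ) : ℝ≥0∞ :=
  ∫⁻ w, (altLaw P n m).rnDeriv (nullLaw P n m) w ^ 2 ∂nullLaw P n m

end Model

/-- Strong detection is possible along a sequence of problems, the `n`-th one with joint law `P n`
and sample sizes `n` and `m n`: there are tests, given by their rejection regions `A n`, whose
Type-I and Type-II error probabilities both vanish as `n → ∞`. -/
def StrongDetectionPossible {X : ℕ → Type u} {Y : ℕ → Type v}
    [∀ n, MeasurableSpace (X n)] [∀ n, MeasurableSpace (Y n)]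
    (P : ∀ n, Measure (X n × Y n)) (m : ℕ → ℕ) : Prop :=
  ∃ A : ∀ n, Set ((Fin n → X n) × (Fin (m n) → Y n)),
    (∀ n, MeasurableSet (A n)) ∧
    Tendsto (fun n => nullLaw (P n) n (m n) (A n)) atTop (𝓝 0) ∧
    Tendsto (fun n => altLaw (P n) n (m n) (A n)ᶜ) atTop (𝓝 0)

end

end BrokenSample

open BrokenSample

namespace BrokenSample

/-! ### Generating functions of monomials over finitely supported exponents -/

section Generating

theorem tsum_pi_prod {ι : Type*} : ∀ {m : ℕ} (f : Fin m → ι → ℝ≥0∞),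
    ∑' k : Fin m → ι, ∏ i, f i (k i) = ∏ i, ∑' x, f i x
  | 0, f => by simp [tsum_fintype]
  | m + 1, f => by
    rw [← (Fin.consEquiv fun _ => ι).tsum_eq, Fin.prod_univ_succ, ← tsum_pi_prod,
      ← ENNReal.tsum_mul_right, ENNReal.tsum_prod']
    refine tsum_congr fun x => ?_
    rw [← ENNReal.tsum_mul_left]
    refine tsum_congr fun k => ?_
    simp [Fin.consEquiv, Fin.prod_univ_succ]

/-- The monomial `∏ b_x ^ α_x`. -/
noncomputable def monomialEval {J : Type*} (b : J → ℝ≥0∞) (α : J →₀ ℕ) : ℝ≥0∞ :=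
  α.prod fun x e => b x ^ e

theorem monomialEval_mul_const {J : Type*} (b : J → ℝ≥0∞) (t : ℝ≥0∞) (α : J →₀ ℕ) :
    monomialEval (fun x => t * b x) α = t ^ α.degree * monomialEval b α := by
  simp only [monomialEval, Finsupp.prod, mul_pow, Finset.prod_mul_distrib, Finsupp.degree_apply,
    Finset.prod_pow_eq_pow_sum]

/-- A finite product of geometric series, multiplied out. In `ℝ≥0∞` this needs no convergence
condition, a factor with `b k ≥ 1` being `∞`. -/
theorem tsum_monomialEval_range (b : ℕ → ℝ≥0∞) (N : ℕ) :
    ∑' v : Fin N → ℕ, monomialEval b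
      (Finsupp.embDomain Fin.valEmbedding (Finsupp.equivFunOnFinite.symm v)) =
      ∏ k ∈ Finset.range N, (1 - b k)⁻¹ := by
  simp_rw [Finset.prod_range, ← ENNReal.tsum_geometric]
  rw [← tsum_pi_prod]
  refine tsum_congr fun v => ?_
  rw [monomialEval, Finsupp.prod_embDomain, Finsupp.prod_fintype _ _ (by simp)]
  rfl

/-- Finitely many exponents involve finitely many variables, so each finite partial sum lies below
one of the finite products; conversely each finite product is a subsum. -/
theorem tsum_monomialEval (b : ℕ → ℝ≥0∞) :
    ∑' α : ℕ →₀ ℕ, monomialEval b α = ⨆ N, ∏ k ∈ Finset.range N, (1 - b k)⁻¹ := by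
  apply le_antisymm
  · rw [ENNReal.tsum_eq_iSup_sum]
    refine iSup_le fun s => ?_
    obtain ⟨N, hN⟩ : ∃ N, ∀ α ∈ s, ∀ k ∈ α.support, k < N := by
      refine ⟨(s.biUnion Finsupp.support).sup id + 1, fun α hα k hk => ?_⟩
      exact Nat.lt_succ_of_le (Finset.le_sup (f := id) (Finset.mem_biUnion.2 ⟨α, hα, hk⟩))
    refine le_trans ?_ (le_iSup _ N)
    rw [← tsum_monomialEval_range]
    have hinj : Function.Injective fun v : Fin N → ℕ =>
        Finsupp.embDomain Fin.valEmbedding (Finsupp.equivFunOnFinite.symm v) :=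
      (Finsupp.embDomain_injective _).comp (Equiv.injective _)
    have hpre : ∀ α ∈ s, ∃ v : Fin N → ℕ,
        Finsupp.embDomain Fin.valEmbedding (Finsupp.equivFunOnFinite.symm v) = α := by
      intro α hα
      refine ⟨fun i => α i, Finsupp.ext fun k => ?_⟩
      by_cases hk : k < N
      · have := Finsupp.embDomain_apply_self Fin.valEmbedding
          (Finsupp.equivFunOnFinite.symm fun i : Fin N => α i) ⟨k, hk⟩
        simpa using this
      · rw [Finsupp.embDomain_of_notMem_range]
        · by_contra h
          exact hk (hN α hα k (Finsupp.mem_support_iff.2 (Ne.symm h)))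
        · rintro ⟨i, rfl⟩
          exact hk i.2
    calc ∑ α ∈ s, monomialEval b α = ∑' α : s, monomialEval b α := (Finset.tsum_subtype s _).symm
      _ = ∑' α : s, monomialEval b (Finsupp.embDomain Fin.valEmbedding
            (Finsupp.equivFunOnFinite.symm (hpre α α.2).choose)) :=
          tsum_congr fun α => by rw [(hpre α α.2).choose_spec]
      _ ≤ _ := by
          refine ENNReal.tsum_comp_le_tsum_of_injective (f := fun α : s => (hpre α α.2).choose)
            (fun α β h => Subtype.ext ?_) (fun v => monomialEval b
              (Finsupp.embDomain Fin.valEmbedding (Finsupp.equivFunOnFinite.symm v)))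
          rw [← (hpre α α.2).choose_spec, ← (hpre β β.2).choose_spec]
          simp only at h
          rw [h]
  · refine iSup_le fun N => ?_
    rw [← tsum_monomialEval_range]
    exact ENNReal.tsum_comp_le_tsum_of_injective
      ((Finsupp.embDomain_injective _).comp (Equiv.injective _)) _

/-- Every factor is at least `1`, so the partial products increase and their supremum is the
infinite product. -/
theorem tsum_monomialEval_ofReal {w : ℕ → ℝ} (h0 : ∀ k, 0 ≤ w k) (h1 : ∀ k, w k < 1)
    (hm : Multipliable fun k => 1 / (1 - w k)) :
    ∑' α : ℕ →₀ ℕ, monomialEval (fun k => ENNReal.ofReal (w k)) α =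
      ENNReal.ofReal (∏' k, 1 / (1 - w k)) := by
  rw [tsum_monomialEval]
  have hk : ∀ k, (1 - ENNReal.ofReal (w k))⁻¹ = ENNReal.ofReal (1 / (1 - w k)) := fun k => by
    rw [one_div, ENNReal.ofReal_inv_of_pos (by linarith [h1 k]),
      ENNReal.ofReal_sub _ (h0 k), ENNReal.ofReal_one]
  have hprod : ∀ N, ∏ k ∈ Finset.range N, (1 - ENNReal.ofReal (w k))⁻¹ =
      ENNReal.ofReal (∏ k ∈ Finset.range N, 1 / (1 - w k)) := fun N => by
    rw [ENNReal.ofReal_prod_of_nonneg fun k _ => by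
      have := h1 k; exact one_div_nonneg.2 (by linarith)]
    exact Finset.prod_congr rfl fun k _ => hk k
  simp_rw [hprod]
  refine iSup_eq_of_tendsto ?_
    ((ENNReal.continuous_ofReal.tendsto _).comp hm.hasProd.tendsto_prod_nat)
  refine monotone_nat_of_le_succ fun N => ENNReal.ofReal_le_ofReal ?_
  rw [Finset.prod_range_succ]
  refine le_mul_of_one_le_right (Finset.prod_nonneg fun k _ => ?_) ?_
  · have := h1 k
    exact one_div_nonneg.2 (by linarith)
  · rw [le_div_iff₀ (by linarith [h1 N])]
    linarith [h0 N]

/-- Write the factor as `1 + w/(1 - w)`; here `w/(1 - w) ≤ 2w` as soon as `w < 1/2`. -/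
theorem multipliable_one_div_one_sub {w : ℕ → ℝ} (h0 : ∀ k, 0 ≤ w k) (h1 : ∀ k, w k < 1)
    (hs : Summable w) : Multipliable fun k => 1 / (1 - w k) := by
  have hev : ∀ᶠ k in cofinite, w k < 1 / 2 :=
    hs.tendsto_cofinite_zero.eventually (gt_mem_nhds (by norm_num))
  have hs' : Summable fun k => w k / (1 - w k) := by
    refine Summable.of_norm_bounded_eventually (hs.mul_left 2) ?_
    filter_upwards [hev] with k hk
    have := h0 k
    rw [Real.norm_of_nonneg (div_nonneg this (by linarith)), div_le_iff₀ (by linarith)]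
    nlinarith
  refine (Real.multipliable_one_add_of_summable hs').congr fun k => ?_
  have : 1 - w k ≠ 0 := by linarith [h1 k]
  field_simp
  ring

theorem tprod_one_div_one_sub_nonneg {w : ℕ → ℝ} (h0 : ∀ k, 0 ≤ w k) (h1 : ∀ k, w k < 1)
    (hs : Summable w) : 0 ≤ ∏' k, 1 / (1 - w k) :=
  ge_of_tendsto' (multipliable_one_div_one_sub h0 h1 hs).hasProd.tendsto_prod_nat fun _ =>
    Finset.prod_nonneg fun k _ => one_div_nonneg.2 (by linarith [h1 k])

/-- Since `1 - w ≥ c`, each factor is at most `1 + w/c ≤ exp(w/c)`. -/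
theorem tprod_one_div_one_sub_le {w : ℕ → ℝ} {c B : ℝ} (hc : 0 < c) (h0 : ∀ k, 0 ≤ w k)
    (h1 : ∀ k, w k ≤ 1 - c) (hs : Summable w) (hB : ∑' k, w k ≤ B) :
    ∏' k, 1 / (1 - w k) ≤ Real.exp (B / c) := by
  have hm := multipliable_one_div_one_sub h0 (fun k => by linarith [h1 k]) hs
  refine le_of_tendsto' hm.hasProd.tendsto_prod_nat fun N => ?_
  calc ∏ k ∈ Finset.range N, 1 / (1 - w k)
      ≤ ∏ k ∈ Finset.range N, Real.exp (w k / c) := by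
        refine Finset.prod_le_prod (fun k _ => one_div_nonneg.2 (by linarith [h1 k])) fun k _ => ?_
        have hp : 0 < 1 - w k := by linarith [h1 k]
        refine le_trans ?_ (Real.add_one_le_exp _)
        rw [div_le_iff₀ hp, div_add_one hc.ne', div_mul_eq_mul_div, le_div_iff₀ hc]
        nlinarith [h0 k, h1 k, mul_nonneg (h0 k) (sub_nonneg.2 (h1 k))]
    _ = Real.exp ((∑ k ∈ Finset.range N, w k) / c) := by
        rw [← Real.exp_sum, Finset.sum_div]
    _ ≤ _ := Real.exp_le_exp.2 (div_le_div_of_nonneg_right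
        ((hs.sum_le_tsum _ fun k _ => h0 k).trans hB) hc.le)

/-- A monomial containing a variable outside the range of `f` vanishes. This passes from the nonzero
singular values to the whole sequence continued by zeros. -/
theorem tsum_monomialEval_embedding {J I : Type*} (f : J ↪ I) (b : I → ℝ≥0∞)
    (hb : ∀ k, k ∉ range f → b k = 0) (q : ℕ → ℝ≥0∞) :
    ∑' α : J →₀ ℕ, monomialEval (fun x => b (f x)) α * q α.degree =
      ∑' α : I →₀ ℕ, monomialEval b α * q α.degree := by
  rw [← (Finsupp.embDomain_injective f).tsum_eq
    (f := fun α : I →₀ ℕ => monomialEval b α * q α.degree)]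
  · refine tsum_congr fun α => ?_
    rw [monomialEval, monomialEval, Finsupp.prod_embDomain]
    congr 2
    simp [Finsupp.degree_apply, Finsupp.support_embDomain, Finsupp.embDomain_apply_self]
  · intro α hα
    have hne : monomialEval b α ≠ 0 := left_ne_zero_of_mul hα
    have hsub : ∀ k ∈ α.support, k ∈ range f := by
      intro k hk
      by_contra hkf
      refine hne (Finset.prod_eq_zero hk ?_)
      simp only [hb k hkf]
      exact zero_pow (Finsupp.mem_support_iff.1 hk)
    refine ⟨α.comapDomain f f.injective.injOn, ?_⟩
    exact Finsupp.embDomain_comapDomain (by intro k hk; exact hsub k hk)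

end Generating

/-! ### Random injections acting on words, and orbits of words -/

section Counting

open Classical in
/-- Injections `[m] → [n]` whose range contains a given `r`-set. -/
theorem card_embedding_superset (n m : ℕ) (S : Finset (Fin n)) :
    (Finset.univ.filter fun π : Fin m ↪ Fin n => ∀ j ∈ S, j ∈ range π).card * n.choose S.card =
      Fintype.card (Fin m ↪ Fin n) * m.choose S.card := by
  -- The count depends only on the size of the set: composing with a permutation that carries `S'`
  -- to `S` is a bijection between the two families.
  have hconst : ∀ S' ∈ Finset.powersetCard S.card (Finset.univ : Finset (Fin n)),
      (Finset.univ.filter fun π : Fin m ↪ Fin n => ∀ j ∈ S', j ∈ range π).card =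
      (Finset.univ.filter fun π : Fin m ↪ Fin n => ∀ j ∈ S, j ∈ range π).card := by
    intro S' hS'
    have hcard : S'.card = S.card := (Finset.mem_powersetCard.1 hS').2
    obtain ⟨τ, hτ⟩ : ∃ τ : Equiv.Perm (Fin n), ∀ j, τ j ∈ S ↔ j ∈ S' := by
      let e : {j // j ∈ S'} ≃ {j // j ∈ S} := Fintype.equivOfCardEq (by simpa using hcard)
      refine ⟨e.extendSubtype, fun j => ⟨fun h => ?_, fun h => e.extendSubtype_mem j h⟩⟩
      by_contra hj
      exact e.extendSubtype_not_mem j hj h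
    refine Finset.card_bij (fun π _ => π.trans τ.toEmbedding) ?_ ?_ ?_
    · intro π hπ
      simp only [Finset.mem_filter, Finset.mem_univ, true_and] at hπ ⊢
      intro j hj
      obtain ⟨i, hi⟩ := hπ (τ.symm j) ((hτ _).1 (by simpa using hj))
      exact ⟨i, by simp [hi]⟩
    · intro π _ π' _ h
      ext i
      have := DFunLike.congr_fun h i
      simpa using congrArg Fin.val (τ.injective this)
    · intro π hπ
      simp only [Finset.mem_filter, Finset.mem_univ, true_and] at hπ
      refine ⟨π.trans τ.symm.toEmbedding, ?_, ?_⟩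
      · simp only [Finset.mem_filter, Finset.mem_univ, true_and]
        intro j hj
        obtain ⟨i, hi⟩ := hπ (τ j) ((hτ j).2 hj)
        exact ⟨i, by simp [hi]⟩
      · ext i
        simp
  have hsub : ∀ π : Fin m ↪ Fin n,
      ((Finset.powersetCard S.card (Finset.univ : Finset (Fin n))).filter
        fun S' => ∀ j ∈ S', j ∈ range π).card = m.choose S.card := by
    intro π
    have : ((Finset.powersetCard S.card (Finset.univ : Finset (Fin n))).filter
        fun S' => ∀ j ∈ S', j ∈ range π) =
        Finset.powersetCard S.card (Finset.univ.map π) := by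
      ext S'
      simp only [Finset.mem_filter, Finset.mem_powersetCard, Finset.subset_univ, true_and]
      rw [and_comm]
      refine and_congr_left fun _ => forall₂_congr fun j _ => ?_
      simp
    rw [this, Finset.card_powersetCard, Finset.card_map, Finset.card_univ, Fintype.card_fin]
  -- Double counting of the pairs of an injection and a set of size `S.card` inside its range.
  have h := Finset.sum_card_bipartiteAbove_eq_sum_card_bipartiteBelow
    (s := (Finset.univ : Finset (Fin m ↪ Fin n)))
    (t := Finset.powersetCard S.card (Finset.univ : Finset (Fin n)))
    (fun (π : Fin m ↪ Fin n) S' => ∀ j ∈ S', j ∈ range π)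
  simp only [Finset.bipartiteAbove, Finset.bipartiteBelow] at h
  rw [Finset.sum_congr rfl hconst, Finset.sum_congr rfl fun π _ => hsub π] at h
  simp only [Finset.sum_const, Finset.card_powersetCard, Finset.card_univ, Fintype.card_fin,
    smul_eq_mul] at h
  rw [h, mul_comm]

variable {ι : Type*} (o : ι)

/-- The word on `[n]` that carries the letter `k i` at the place `π i` and `o` elsewhere. -/
noncomputable def spread {n m : ℕ} (π : Fin m ↪ Fin n) (k : Fin m → ι) : Fin n → ι :=
  Function.extend π k fun _ => o

theorem spread_apply {n m : ℕ} (π : Fin m ↪ Fin n) (k : Fin m → ι) (i : Fin m) :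
    spread o π k (π i) = k i := π.injective.extend_apply _ _ _

theorem spread_of_notMem {n m : ℕ} (π : Fin m ↪ Fin n) (k : Fin m → ι) {j : Fin n}
    (hj : j ∉ range π) : spread o π k j = o := Function.extend_apply' _ _ _ hj

theorem prod_spread {M : Type*} [CommMonoid M] {n m : ℕ} (π : Fin m ↪ Fin n) (k : Fin m → ι)
    (g : ι → M) (hg : g o = 1) : ∏ j, g (spread o π k j) = ∏ i, g (k i) := by
  classical
  have h : ∏ i, g (k i) = ∏ j ∈ Finset.univ.map π, g (spread o π k j) := by
    rw [Finset.prod_map]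
    exact Finset.prod_congr rfl fun i _ => by rw [spread_apply]
  rw [h]
  refine (Finset.prod_subset (Finset.subset_univ _) fun j _ hj => ?_).symm
  rw [spread_of_notMem o π k (by simpa using hj), hg]

theorem sum_spread {M : Type*} [AddCommMonoid M] {n m : ℕ} (π : Fin m ↪ Fin n) (k : Fin m → ι)
    (g : ι → M) (hg : g o = 0) : ∑ j, g (spread o π k j) = ∑ i, g (k i) :=
  prod_spread (M := Multiplicative M) o π k g hg

open Classical in
/-- The unit count of a letter, `0` for the blank letter `o`. -/
noncomputable def unitCount (x : ι) : {x : ι // x ≠ o} →₀ ℕ :=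
  if h : x ≠ o then Finsupp.single ⟨x, h⟩ 1 else 0

/-- The numbers of occurrences of the letters other than `o`. -/
noncomputable def letterCount {n : ℕ} (κ : Fin n → ι) : {x : ι // x ≠ o} →₀ ℕ :=
  ∑ j, unitCount o (κ j)

theorem unitCount_self : unitCount o o = 0 := by simp [unitCount]

theorem letterCount_spread {n m : ℕ} (π : Fin m ↪ Fin n) (k : Fin m → ι) :
    letterCount o (spread o π k) = letterCount o k :=
  sum_spread o π k (unitCount o) (unitCount_self o)

theorem monomialEval_letterCount (a : ι → ℝ≥0∞) (ha : a o = 1) {n : ℕ} (κ : Fin n → ι) :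
    monomialEval (fun x : {x : ι // x ≠ o} => a x) (letterCount o κ) = ∏ j, a (κ j) := by
  rw [monomialEval, letterCount, ← Finsupp.prod_finsetSum_index (by simp)
    (by intros; exact pow_add _ _ _)]
  refine Finset.prod_congr rfl fun j _ => ?_
  by_cases h : κ j = o
  · simp [unitCount, h, ha]
  · simp [unitCount, h]

open Classical in
theorem letterCount_apply {n : ℕ} (κ : Fin n → ι) (x : {x : ι // x ≠ o}) :
    letterCount o κ x = (Finset.univ.filter fun j => κ j = x).card := by
  rw [letterCount, Finsupp.finsetSum_apply, Finset.card_filter]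
  refine Finset.sum_congr rfl fun j _ => ?_
  by_cases h : κ j = o
  · have : ¬ κ j = x := fun hx => x.2 (hx ▸ h)
    simp [unitCount, h]
    simpa [h] using this
  · simp [unitCount, h, Finsupp.single_apply, Subtype.ext_iff]

open Classical in
theorem degree_letterCount {n : ℕ} (κ : Fin n → ι) :
    (letterCount o κ).degree = (Finset.univ.filter fun j => κ j ≠ o).card := by
  rw [letterCount, map_sum, Finset.card_filter]
  refine Finset.sum_congr rfl fun j _ => ?_
  by_cases h : κ j = o
  · simp [unitCount, h]
  · simp [unitCount, h]

/-- Both words have fibres of equal size over every letter, and bijections of fibres glue. The blank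
is not recorded by `letterCount`; its multiplicity is `n` minus the degree. -/
theorem exists_perm_of_letterCount_eq {n : ℕ} {κ κ' : Fin n → ι}
    (h : letterCount o κ = letterCount o κ') : ∃ τ : Equiv.Perm (Fin n), ∀ j, κ' (τ j) = κ j := by
  classical
  have hcard : ∀ x, Fintype.card {j // κ j = x} = Fintype.card {j // κ' j = x} := by
    intro x
    rw [Fintype.card_subtype, Fintype.card_subtype]
    by_cases hx : x = o
    · subst hx
      have h1 := degree_letterCount x κ
      have h2 := degree_letterCount x κ'
      rw [h] at h1
      have h3 := Finset.card_filter_add_card_filter_not (s := (Finset.univ : Finset (Fin n)))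
        (fun j => κ j = x)
      have h4 := Finset.card_filter_add_card_filter_not (s := (Finset.univ : Finset (Fin n)))
        (fun j => κ' j = x)
      simp only [ne_eq] at h1 h2
      omega
    · rw [← letterCount_apply o κ ⟨x, hx⟩, ← letterCount_apply o κ' ⟨x, hx⟩, h]
  exact ⟨Equiv.ofFiberEquiv fun x => Fintype.equivOfCardEq (hcard x),
    fun j => Equiv.ofFiberEquiv_map _ j⟩

/-- Induction on the degree: realise `α` with one letter removed; as its degree is less than `n`, a
blank place remains, and the letter is written there. -/
theorem exists_letterCount_eq {n : ℕ} (r : ℕ) : ∀ α : {x : ι // x ≠ o} →₀ ℕ, α.degree = r → r ≤ n →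
    ∃ κ : Fin n → ι, letterCount o κ = α := by
  classical
  induction r with
  | zero =>
    intro α hα _
    refine ⟨fun _ => o, ?_⟩
    rw [(Finsupp.degree_eq_zero_iff α).1 hα]
    simp [letterCount, unitCount_self]
  | succ r ih =>
    intro α hα hr
    have hne : α ≠ 0 := by
      rintro rfl
      simp at hα
    obtain ⟨x, hx⟩ := Finsupp.ne_iff.1 hne
    have hle : Finsupp.single x 1 ≤ α := by
      rw [Finsupp.single_le_iff]
      exact Nat.one_le_iff_ne_zero.2 hx
    have hsplit : α - Finsupp.single x 1 + Finsupp.single x 1 = α := tsub_add_cancel_of_le hle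
    have hdeg : (α - Finsupp.single x 1).degree = r := by
      have := congrArg Finsupp.degree hsplit
      rw [map_add, Finsupp.degree_single, hα] at this
      omega
    obtain ⟨κ, hκ⟩ := ih _ hdeg (by omega)
    obtain ⟨j, hj⟩ : ∃ j, κ j = o := by
      by_contra! hall
      have := degree_letterCount o κ
      rw [hκ, hdeg, Finset.filter_true_of_mem fun j _ => hall j, Finset.card_univ,
        Fintype.card_fin] at this
      omega
    refine ⟨Function.update κ j x, ?_⟩
    rw [← hsplit, ← hκ, letterCount, letterCount,
      ← Finset.sum_erase_add _ _ (Finset.mem_univ j),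
      ← Finset.sum_erase_add (a := j) (f := fun j => unitCount o (κ j)) _ (Finset.mem_univ j),
      Function.update_self, hj, unitCount_self, add_zero]
    congr 1
    · refine Finset.sum_congr rfl fun i hi => ?_
      rw [Function.update_of_ne (Finset.ne_of_mem_erase hi)]
    · simp [unitCount, x.2]

open Classical in
/-- The probability that a uniformly random injection spreads `k` into `κ`. -/
noncomputable def spreadProb {n m : ℕ} (k : Fin m → ι) (κ : Fin n → ι) : ℝ≥0∞ :=
  ((Finset.univ.filter fun π : Fin m ↪ Fin n => spread o π k = κ).card : ℝ≥0∞) /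
    Fintype.card (Fin m ↪ Fin n)

theorem card_embedding_ne_zero {n m : ℕ} (hmn : m ≤ n) :
    (Fintype.card (Fin m ↪ Fin n) : ℝ≥0∞) ≠ 0 := by
  have : Nonempty (Fin m ↪ Fin n) := ⟨Fin.castLEEmb hmn⟩
  exact_mod_cast Fintype.card_ne_zero

/-- The uniform law on injections is invariant under composition with permutations of `[n]`, and
these act transitively on words with given letter counts. -/
theorem spreadProb_comp_perm {n m : ℕ} (k : Fin m → ι) {κ κ' : Fin n → ι}
    (h : letterCount o κ = letterCount o κ') : spreadProb o k κ = spreadProb o k κ' := by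
  classical
  obtain ⟨τ, hτ⟩ := exists_perm_of_letterCount_eq o h
  have key : ∀ (π : Fin m ↪ Fin n), spread o (π.trans τ.toEmbedding) k = κ' ↔ spread o π k = κ := by
    intro π
    have hs : ∀ j, spread o (π.trans τ.toEmbedding) k (τ j) = spread o π k j := by
      intro j
      by_cases hj : j ∈ range π
      · obtain ⟨i, rfl⟩ := hj
        rw [spread_apply]
        exact spread_apply o (π.trans τ.toEmbedding) k i
      · rw [spread_of_notMem o π k hj, spread_of_notMem]
        rintro ⟨i, hi⟩
        exact hj ⟨i, τ.injective hi⟩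
    constructor
    · intro h'
      funext j
      rw [← hs, h', hτ]
    · intro h'
      funext j
      obtain ⟨j, rfl⟩ := τ.surjective j
      rw [hs, h', hτ]
  unfold spreadProb
  congr 2
  refine Finset.card_bij (fun π _ => π.trans τ.toEmbedding) ?_ ?_ ?_
  · intro π hπ
    simpa [key] using hπ
  · intro π _ π' _ h
    ext i
    have := DFunLike.congr_fun h i
    simpa using congrArg Fin.val (τ.injective this)
  · intro π hπ
    have hπ' : (π.trans τ.symm.toEmbedding).trans τ.toEmbedding = π := by
      ext i
      simp
    refine ⟨π.trans τ.symm.toEmbedding, ?_, hπ'⟩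
    simp only [Finset.mem_filter, Finset.mem_univ, true_and] at hπ ⊢
    rw [← key, hπ', hπ]

theorem letterCount_eq_of_spreadProb_ne_zero {n m : ℕ} {k : Fin m → ι} {κ : Fin n → ι}
    (h : spreadProb o k κ ≠ 0) : letterCount o κ = letterCount o k := by
  classical
  have hne : (Finset.univ.filter fun π : Fin m ↪ Fin n => spread o π k = κ).card ≠ 0 := by
    intro h0
    exact h (by simp [spreadProb, h0])
  obtain ⟨π, hπ⟩ := Finset.card_ne_zero.1 hne
  rw [← (Finset.mem_filter.1 hπ).2, letterCount_spread]

open Classical in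
theorem spreadProb_eq_sum {n m : ℕ} (k : Fin m → ι) (κ : Fin n → ι) :
    spreadProb o k κ = ∑ π : Fin m ↪ Fin n, (if spread o π k = κ then 1 else 0) *
      (Fintype.card (Fin m ↪ Fin n) : ℝ≥0∞)⁻¹ := by
  rw [spreadProb, Finset.card_filter, ← Finset.sum_mul, div_eq_mul_inv]
  push_cast
  rfl

theorem tsum_spreadProb {n m : ℕ} (hmn : m ≤ n) (k : Fin m → ι) :
    ∑' κ : Fin n → ι, spreadProb o k κ = 1 := by
  classical
  simp_rw [spreadProb_eq_sum]
  rw [Summable.tsum_finsetSum fun _ _ => ENNReal.summable]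
  simp_rw [ENNReal.tsum_mul_right, tsum_ite_eq']
  rw [Finset.sum_const, Finset.card_univ, nsmul_eq_mul, one_mul,
    ENNReal.mul_inv_cancel (card_embedding_ne_zero hmn) (by simp)]

open Classical in
/-- The number of words with the same letter counts. -/
noncomputable def orbitCard {n : ℕ} (α : {x : ι // x ≠ o} →₀ ℕ) : ℝ≥0∞ :=
  ∑' κ : Fin n → ι, if letterCount o κ = α then 1 else 0

/-- The randomly spread word always has the letter counts of `k` and is uniform among the words with
these counts. -/
theorem spreadProb_mul_orbitCard {n m : ℕ} (hmn : m ≤ n) {k : Fin m → ι} {κ : Fin n → ι}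
    (h : spreadProb o k κ ≠ 0) : spreadProb o k κ * orbitCard (n := n) o (letterCount o κ) = 1 := by
  classical
  rw [← tsum_spreadProb o hmn k, orbitCard, ← ENNReal.tsum_mul_left]
  refine tsum_congr fun κ' => ?_
  by_cases hc : letterCount o κ' = letterCount o κ
  · rw [if_pos hc, mul_one, spreadProb_comp_perm o k hc]
  · rw [if_neg hc, mul_zero]
    by_contra h'
    exact hc ((letterCount_eq_of_spreadProb_ne_zero o (Ne.symm h')).trans
      (letterCount_eq_of_spreadProb_ne_zero o h).symm)

/-- The decisive linearisation: one factor of the square becomes a weight that depends on `κ` alone,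
so the sum over `k` is linear in the probability. -/
theorem spreadProb_sq {n m : ℕ} (hmn : m ≤ n) (k : Fin m → ι) (κ : Fin n → ι) :
    spreadProb o k κ ^ 2 = spreadProb o k κ * (orbitCard (n := n) o (letterCount o κ))⁻¹ := by
  by_cases h : spreadProb o k κ = 0
  · simp [h]
  · rw [sq, ← ENNReal.eq_inv_of_mul_eq_one_left (spreadProb_mul_orbitCard o hmn h)]

/-- The probability that the range of a random injection `[m] → [n]` contains a given `r`-set. -/
noncomputable def coverProb (n m r : ℕ) : ℝ := (m.choose r : ℝ) / n.choose r

/-- For fixed `π` only `k = κ ∘ π` can spread to `κ`, and it does so exactly when the range of `π`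
covers the nonblank places of `κ`. The weights of `k` and `κ` then agree because blanks weigh `1`.
-/
theorem tsum_prod_mul_spreadProb {n m : ℕ} (hmn : m ≤ n) (a : ι → ℝ≥0∞) (ha : a o = 1)
    (κ : Fin n → ι) :
    ∑' k : Fin m → ι, (∏ i, a (k i)) * spreadProb o k κ =
      (∏ j, a (κ j)) * ENNReal.ofReal (coverProb n m (letterCount o κ).degree) := by
  classical
  set S := Finset.univ.filter fun j => κ j ≠ o with hS
  have hinner : ∀ π : Fin m ↪ Fin n,
      ∑' k : Fin m → ι, (∏ i, a (k i)) * (if spread o π k = κ then 1 else 0) =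
        (∏ j, a (κ j)) * if ∀ j ∈ S, j ∈ range π then 1 else 0 := by
    intro π
    split_ifs with h
    · have hκ : spread o π (fun i => κ (π i)) = κ := by
        funext j
        by_cases hj : j ∈ range π
        · obtain ⟨i, rfl⟩ := hj
          rw [spread_apply]
        · rw [spread_of_notMem o _ _ hj]
          by_contra hne
          exact hj (h j (by simpa [hS] using Ne.symm hne))
      rw [tsum_eq_single fun i => κ (π i)]
      · rw [if_pos hκ, ← prod_spread o π _ a ha, hκ]
      · intro k hk
        rw [if_neg, mul_zero]
        rintro rfl
        exact hk (funext fun i => (spread_apply o π k i).symm)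
    · rw [mul_zero]
      refine ENNReal.tsum_eq_zero.2 fun k => ?_
      rw [if_neg, mul_zero]
      rintro rfl
      refine h fun j hj => ?_
      by_contra hj'
      exact (Finset.mem_filter.1 hj).2 (spread_of_notMem o π k hj')
  have hcov : ((Finset.univ.filter fun π : Fin m ↪ Fin n => ∀ j ∈ S, j ∈ range π).card : ℝ≥0∞) *
      (Fintype.card (Fin m ↪ Fin n) : ℝ≥0∞)⁻¹ =
      ENNReal.ofReal (coverProb n m (letterCount o κ).degree) := by
    rw [degree_letterCount, ← hS, coverProb]
    have hle : S.card ≤ n := by simpa using Finset.card_le_univ S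
    have hpos : 0 < n.choose S.card := Nat.choose_pos hle
    rw [ENNReal.ofReal_div_of_pos (by exact_mod_cast hpos), ENNReal.ofReal_natCast,
      ENNReal.ofReal_natCast, ← div_eq_mul_inv,
      ENNReal.div_eq_div_iff (by exact_mod_cast hpos.ne') (by simp) (card_embedding_ne_zero hmn)
        (by simp)]
    have := card_embedding_superset n m S
    rw [mul_comm (n.choose S.card : ℝ≥0∞)]
    exact_mod_cast this
  simp_rw [spreadProb_eq_sum, Finset.mul_sum, ← mul_assoc]
  rw [Summable.tsum_finsetSum fun _ _ => ENNReal.summable]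
  simp_rw [ENNReal.tsum_mul_right, hinner]
  rw [← Finset.sum_mul, ← Finset.mul_sum, mul_assoc, ← hcov, Finset.card_filter]
  push_cast
  rfl

/-- The second moment of the spreading kernel as a sum over monomials. -/
theorem tsum_prod_mul_spreadProb_sq {n m : ℕ} (hmn : m ≤ n) (a : ι → ℝ≥0∞) (ha : a o = 1) :
    ∑' (κ : Fin n → ι) (k : Fin m → ι), (∏ i, a (k i)) * spreadProb o k κ ^ 2 =
      ∑' α : {x : ι // x ≠ o} →₀ ℕ, monomialEval (fun x : {x : ι // x ≠ o} => a x) α *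
        ENNReal.ofReal (coverProb n m α.degree) := by
  classical
  have h1 : ∀ κ : Fin n → ι, ∑' k : Fin m → ι, (∏ i, a (k i)) * spreadProb o k κ ^ 2 =
      ∑' α : {x : ι // x ≠ o} →₀ ℕ, (if letterCount o κ = α then 1 else 0) *
        (monomialEval (fun x : {x : ι // x ≠ o} => a x) α *
        ENNReal.ofReal (coverProb n m α.degree) * (orbitCard (n := n) o α)⁻¹) := by
    intro κ
    rw [tsum_eq_single (letterCount o κ)]
    · rw [if_pos rfl, one_mul]
      simp_rw [spreadProb_sq o hmn, ← mul_assoc]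
      rw [ENNReal.tsum_mul_right, tsum_prod_mul_spreadProb o hmn a ha,
        monomialEval_letterCount o a ha]
    · intro α hα
      rw [if_neg (Ne.symm hα), zero_mul]
  simp_rw [h1]
  rw [ENNReal.tsum_comm]
  refine tsum_congr fun α => ?_
  rw [ENNReal.tsum_mul_right, ← orbitCard]
  -- This case is separated because beyond degree `n` the orbit is empty and its size cannot be
  -- cancelled.
  by_cases hα : ENNReal.ofReal (coverProb n m α.degree) = 0
  · simp [hα]
  have hdeg : α.degree ≤ m := by
    by_contra hlt
    exact hα (by simp [coverProb, Nat.choose_eq_zero_of_lt (not_le.1 hlt)])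
  obtain ⟨κ, hκ⟩ := exists_letterCount_eq (n := n) o _ α rfl (hdeg.trans hmn)
  -- A positive probability times the orbit size is `1`, hence the orbit size is neither `0` nor
  -- `∞`. Such a `k` exists because otherwise the cover probability would vanish, by the previous
  -- identity with all weights `1`.
  obtain ⟨k, hk⟩ : ∃ k : Fin m → ι, spreadProb o k κ ≠ 0 := by
    by_contra! hall
    have := tsum_prod_mul_spreadProb o hmn (fun _ => 1) rfl κ
    simp [hall, hκ] at this
    exact hα (by simpa using this)
  have h := spreadProb_mul_orbitCard o hmn hk
  rw [hκ] at h
  have h0 : orbitCard (n := n) o α ≠ 0 := right_ne_zero_of_mul (h ▸ one_ne_zero)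
  have ht : orbitCard (n := n) o α ≠ ∞ := by
    intro ht
    rw [ht, ENNReal.mul_top hk] at h
    simp at h
  rw [mul_comm, mul_assoc, ENNReal.inv_mul_cancel h0 ht, mul_one]

end Counting

/-! ### The cover probabilities `C(m,r)/C(n,r)` -/

section CoverProb

theorem coverProb_nonneg (n m r : ℕ) : 0 ≤ coverProb n m r := by
  unfold coverProb
  positivity

theorem coverProb_zero (n m : ℕ) : coverProb n m 0 = 1 := by simp [coverProb]

/-- The truncated difference `m - r` supplies the factor `0` from `r = m` on, so no bound of `r` by
`m` is needed. -/
theorem coverProb_succ {n m r : ℕ} (hr : r < n) :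
    coverProb n m (r + 1) = coverProb n m r * (((m - r : ℕ) : ℝ) / ((n - r : ℕ) : ℝ)) := by
  have h1 := Nat.choose_succ_right_eq m r
  have h2 := Nat.choose_succ_right_eq n r
  have h3 : (0 : ℝ) < n.choose r := by exact_mod_cast Nat.choose_pos hr.le
  have h4 : (0 : ℝ) < n.choose (r + 1) := by exact_mod_cast Nat.choose_pos hr
  have h5 : (0 : ℝ) < ((n - r : ℕ) : ℝ) := by exact_mod_cast Nat.sub_pos_of_lt hr
  have h1' : (m.choose (r + 1) : ℝ) * (r + 1) = m.choose r * ((m - r : ℕ) : ℝ) := by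
    exact_mod_cast h1
  have h2' : (n.choose (r + 1) : ℝ) * (r + 1) = n.choose r * ((n - r : ℕ) : ℝ) := by
    exact_mod_cast h2
  have h6 : (0 : ℝ) < (r : ℝ) + 1 := by positivity
  unfold coverProb
  rw [div_mul_div_comm, div_eq_div_iff h4.ne' (by positivity), ← h2', ← h1']
  ring

theorem coverProb_of_lt {n m r : ℕ} (hmn : m ≤ n) (hr : n < r) : coverProb n m r = 0 := by
  simp [coverProb, Nat.choose_eq_zero_of_lt (hmn.trans_lt hr)]

/-- Each successive ratio `(m - r)/(n - r)` is at most `m/n`. -/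
theorem coverProb_le_pow {n m : ℕ} (hmn : m ≤ n) (r : ℕ) :
    coverProb n m r ≤ ((m : ℝ) / n) ^ r := by
  induction r with
  | zero => simp [coverProb_zero]
  | succ r ih =>
    rcases lt_or_ge r n with hr | hr
    · rw [coverProb_succ hr, pow_succ]
      refine mul_le_mul ih ?_ (by positivity) (by positivity)
      have hn : (0 : ℝ) < n := by exact_mod_cast (Nat.zero_le r).trans_lt hr
      have h5 : (0 : ℝ) < ((n - r : ℕ) : ℝ) := by exact_mod_cast Nat.sub_pos_of_lt hr
      rw [div_le_div_iff₀ h5 hn]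
      rcases le_or_gt m r with hm | hm
      · rw [Nat.sub_eq_zero_of_le hm]
        simp only [Nat.cast_zero, zero_mul]
        positivity
      · rw [Nat.cast_sub hm.le, Nat.cast_sub hr.le]
        have : (m : ℝ) ≤ n := by exact_mod_cast hmn
        nlinarith [(Nat.cast_nonneg r : (0 : ℝ) ≤ r)]
    · rw [coverProb_of_lt hmn (Nat.lt_succ_of_le hr)]
      positivity

theorem coverProb_le_one {n m : ℕ} (hmn : m ≤ n) (r : ℕ) : coverProb n m r ≤ 1 :=
  (coverProb_le_pow hmn r).trans (pow_le_one₀ (by positivity)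
    (div_le_one_of_le₀ (by exact_mod_cast hmn) (by positivity)))

theorem coverProb_antitone {n m : ℕ} (hmn : m ≤ n) : Antitone (coverProb n m) := by
  refine antitone_nat_of_succ_le fun r => ?_
  rcases lt_or_ge r n with hr | hr
  · rw [coverProb_succ hr]
    refine mul_le_of_le_one_right (coverProb_nonneg _ _ _) (div_le_one_of_le₀ ?_ (by positivity))
    exact_mod_cast Nat.sub_le_sub_right hmn r
  · rw [coverProb_of_lt hmn (Nat.lt_succ_of_le hr)]
    exact coverProb_nonneg _ _ _

theorem tendsto_coverProb {m : ℕ → ℕ}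
    (h : Tendsto (fun n => (m n : ℝ) / n) atTop (𝓝 1)) (r : ℕ) :
    Tendsto (fun n => coverProb n (m n) r) atTop (𝓝 1) := by
  induction r with
  | zero => simp [coverProb_zero]
  | succ r ih =>
    have hlim : Tendsto (fun n : ℕ => ((m n : ℝ) / n - r / n) / (1 - r / n)) atTop (𝓝 1) := by
      have hr : Tendsto (fun n : ℕ => (r : ℝ) / n) atTop (𝓝 0) :=
        tendsto_const_div_atTop_nhds_zero_nat _
      have := (h.sub hr).div (tendsto_const_nhds.sub hr) (by norm_num : (1 : ℝ) - 0 ≠ 0)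
      rw [sub_zero, div_one] at this
      exact this
    have hmul := ih.mul hlim
    rw [mul_one] at hmul
    refine hmul.congr' ?_
    have hhalf : ∀ᶠ n in atTop, (1 : ℝ) / 2 < (m n : ℝ) / n := h.eventually_const_lt (by norm_num)
    filter_upwards [eventually_gt_atTop (2 * r), hhalf] with n hn hm
    have hn0 : (0 : ℝ) < n := by exact_mod_cast (Nat.zero_le _).trans_lt hn
    have hnr : (2 : ℝ) * r < n := by exact_mod_cast hn
    rw [lt_div_iff₀ hn0] at hm
    have hrm : r ≤ m n := by
      have : (r : ℝ) ≤ m n := by linarith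
      exact_mod_cast this
    have hrn : r < n := by omega
    rw [coverProb_succ hrn, Nat.cast_sub hrm, Nat.cast_sub hrn.le]
    have h1 : (n : ℝ) - r ≠ 0 := by
      have : (r : ℝ) < n := by exact_mod_cast hrn
      linarith
    congr 1
    field_simp

end CoverProb

/-! ### Decreasing rearrangement of a family with finite superlevel sets -/

section Rearrangement

variable {I : Type*} (σ : I → ℝ)

/-- The decreasing rearrangement of a nonnegative family. -/
noncomputable def rearr (k : ℕ) : ℝ :=
  sSup ({0} ∪ {s : ℝ | 0 < s ∧ k + 1 ≤ {i | s ≤ σ i}.ncard})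

variable {σ}

theorem rearr_bddAbove (hfin : ∀ s : ℝ, 0 < s → {i | s ≤ σ i}.Finite)
    (k : ℕ) :
    BddAbove ({0} ∪ {s : ℝ | 0 < s ∧ k + 1 ≤ {i | s ≤ σ i}.ncard}) := by
  obtain ⟨M, hM⟩ := ((hfin 1 one_pos).image σ).bddAbove
  refine ⟨max 1 M, ?_⟩
  rintro s (rfl | ⟨hs, hk⟩)
  · positivity
  · have hne : {i | s ≤ σ i}.Nonempty := Set.nonempty_of_ncard_ne_zero (by omega)
    obtain ⟨i, hi⟩ := hne
    rcases le_or_gt (σ i) 1 with h | h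
    · exact (hi.trans h).trans (le_max_left _ _)
    · exact (hi.trans (hM ⟨i, h.le, rfl⟩)).trans (le_max_right _ _)

theorem rearr_nonneg (hfin : ∀ s : ℝ, 0 < s → {i | s ≤ σ i}.Finite)
    (k : ℕ) : 0 ≤ rearr σ k :=
  le_csSup (rearr_bddAbove hfin k) (Or.inl rfl)

theorem lt_rearr_iff (hfin : ∀ s : ℝ, 0 < s → {i | s ≤ σ i}.Finite)
    {s : ℝ} (hs : 0 < s) (k : ℕ) :
    s < rearr σ k ↔ k + 1 ≤ {i | s < σ i}.ncard := by
  have hf : {i | s < σ i}.Finite := (hfin s hs).subset fun i (hi : s < σ i) => show s ≤ σ i from hi.le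
  constructor
  · intro h
    unfold rearr at h
    obtain ⟨t, ht, hst⟩ := exists_lt_of_lt_csSup (Set.singleton_nonempty 0).inl h
    rcases ht with rfl | ⟨_, hk⟩
    · exact absurd hs hst.not_gt
    · exact hk.trans (Set.ncard_le_ncard (fun i hi => lt_of_lt_of_le hst hi) hf)
  · intro h
    have hne : {i | s < σ i}.Nonempty := Set.nonempty_of_ncard_ne_zero (by omega)
    obtain ⟨i, hi, hmin⟩ := Set.exists_min_image _ σ hf hne
    refine lt_of_lt_of_le hi (le_csSup (rearr_bddAbove hfin k) (Or.inr ⟨hs.trans hi, ?_⟩))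
    exact h.trans (Set.ncard_le_ncard hmin (hfin _ (hs.trans hi)))

/-- The non-strict version says that the supremum is attained; it follows from the strict one
through a gap in the values just below `s`. -/
theorem le_rearr_iff (hfin : ∀ s : ℝ, 0 < s → {i | s ≤ σ i}.Finite)
    {s : ℝ} (hs : 0 < s) (k : ℕ) :
    s ≤ rearr σ k ↔ k + 1 ≤ {i | s ≤ σ i}.ncard := by
  constructor
  · intro h
    have hf : {i | s / 2 ≤ σ i ∧ σ i < s}.Finite :=
      (hfin (s / 2) (by linarith)).subset fun i hi => hi.1
    -- Take for `t` the largest of the finitely many values in `[s/2, s)`, or `s/2` if there is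
    -- none.
    obtain ⟨t, ht0, hts, ht⟩ : ∃ t, 0 < t ∧ t < s ∧ ∀ i, t < σ i → s ≤ σ i := by
      rcases Set.eq_empty_or_nonempty {i | s / 2 ≤ σ i ∧ σ i < s} with he | hne
      · refine ⟨s / 2, by linarith, by linarith, fun i hi => ?_⟩
        by_contra! hlt
        exact (Set.eq_empty_iff_forall_notMem.1 he i) ⟨hi.le, hlt⟩
      · obtain ⟨i, hi, hmax⟩ := Set.exists_max_image _ σ hf hne
        refine ⟨σ i, by linarith [hi.1], hi.2, fun j hj => ?_⟩
        by_contra! hlt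
        exact absurd (hmax j ⟨by linarith [hi.1], hlt⟩) (not_le.2 hj)
    have := (lt_rearr_iff hfin ht0 k).1 (hts.trans_le h)
    exact this.trans (Set.ncard_le_ncard (fun i hi => ht i hi) (hfin s hs))
  · intro h
    exact le_csSup (rearr_bddAbove hfin k) (Or.inr ⟨hs, h⟩)

theorem rearr_antitone (hfin : ∀ s : ℝ, 0 < s → {i | s ≤ σ i}.Finite) :
    Antitone (rearr σ) := by
  intro k l hkl
  rcases (rearr_nonneg hfin l).eq_or_lt with h | h
  · rw [← h]
    exact rearr_nonneg hfin k
  · have := (le_rearr_iff hfin h l).1 le_rfl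
    exact (le_rearr_iff hfin h k).2 (by omega)

/-- For each `c > 0` the positions where the rearrangement equals `c` form the interval from `#{σ >
c}` to `#{σ ≥ c}`, whose length is the multiplicity of `c`. The equivalence is glued from these
fibres. -/
theorem exists_rearr_equiv (hfin : ∀ s : ℝ, 0 < s → {i | s ≤ σ i}.Finite)
    (h0 : ∀ i, 0 ≤ σ i) :
    ∃ e : {k // rearr σ k ≠ 0} ≃ {i // σ i ≠ 0}, ∀ k, σ (e k) = rearr σ k := by
  have hfib : ∀ c : ℝ, Nonempty ({k : {k // rearr σ k ≠ 0} // rearr σ k = c} ≃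
      {i : {i // σ i ≠ 0} // σ i = c}) := by
    intro c
    rcases le_or_gt c 0 with hc | hc
    · have : IsEmpty {k : {k // rearr σ k ≠ 0} // rearr σ k = c} :=
        ⟨fun k => k.1.2 (le_antisymm (k.2.trans_le hc) (rearr_nonneg hfin _))⟩
      have : IsEmpty {i : {i // σ i ≠ 0} // σ i = c} :=
        ⟨fun i => i.1.2 (le_antisymm (i.2.trans_le hc) (h0 _))⟩
      exact ⟨Equiv.equivOfIsEmpty _ _⟩
    · have hf1 : {i | c < σ i}.Finite := (hfin c hc).subset fun i (hi : c < σ i) => show c ≤ σ i from hi.le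
      have hA : {k | rearr σ k = c} =
          ↑(Finset.Ico {i | c < σ i}.ncard {i | c ≤ σ i}.ncard) := by
        ext k
        rw [Finset.coe_Ico, Set.mem_Ico, Set.mem_ofPred_eq, le_antisymm_iff, ← not_lt,
          lt_rearr_iff hfin hc, le_rearr_iff hfin hc]
        omega
      have hB : {i | σ i = c} = {i | c ≤ σ i} \ {i | c < σ i} := by
        ext i
        simp only [Set.mem_ofPred_eq, Set.mem_sdiff, not_lt]
        exact ⟨fun h => ⟨h.ge, h.le⟩, fun h => le_antisymm h.2 h.1⟩
      have hsub : {i | c < σ i} ⊆ {i | c ≤ σ i} := fun i (hi : c < σ i) => show c ≤ σ i from hi.le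
      have hcard : Nat.card {k | rearr σ k = c} = Nat.card {i | σ i = c} := by
        rw [Nat.card_coe_set_eq, Nat.card_coe_set_eq, hA, Set.ncard_coe_finset, Nat.card_Ico, hB,
          Set.ncard_sdiff hsub hf1]
      have : Finite {k | rearr σ k = c} := by
        rw [hA]
        exact Finset.finite_toSet _
      have : Finite {i | σ i = c} := ((hfin c hc).subset fun i hi => hi.ge).to_subtype
      have e := (Finite.card_eq.1 hcard).some
      refine ⟨(Equiv.subtypeSubtypeEquivSubtype fun {k} (h : rearr σ k = c) => ?_).trans
        (e.trans (Equiv.subtypeSubtypeEquivSubtype fun {i} (h : σ i = c) => ?_).symm)⟩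
      · exact h ▸ hc.ne'
      · exact h ▸ hc.ne'
  exact ⟨Equiv.ofFiberEquiv (f := fun k : {k // rearr σ k ≠ 0} => rearr σ k)
    (g := fun i : {i // σ i ≠ 0} => σ i) fun c => (hfib c).some,
    fun k => Equiv.ofFiberEquiv_map (f := fun k : {k // rearr σ k ≠ 0} => rearr σ k)
      (g := fun i : {i // σ i ≠ 0} => σ i) _ k⟩

end Rearrangement

/-! ### Compact operators, eigenbases and singular values -/

section Hilbert

variable {E : Type u} {F : Type v} [NormedAddCommGroup E] [InnerProductSpace ℝ E]
  [NormedAddCommGroup F] [InnerProductSpace ℝ F]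

theorem norm_sub_sum_inner_sq {I : Type*} {e : I → E} (he : Orthonormal ℝ e) (x : E)
    (s : Finset I) :
    ‖x - ∑ i ∈ s, inner ℝ (e i) x • e i‖ ^ 2 = ‖x‖ ^ 2 - ∑ i ∈ s, inner ℝ (e i) x ^ 2 := by
  have h1 : inner ℝ x (∑ i ∈ s, inner ℝ (e i) x • e i) = ∑ i ∈ s, inner ℝ (e i) x ^ 2 := by
    rw [inner_sum]
    refine Finset.sum_congr rfl fun i _ => ?_
    rw [inner_smul_right, real_inner_comm, sq]
  have h2 : ‖∑ i ∈ s, inner ℝ (e i) x • e i‖ ^ 2 = ∑ i ∈ s, inner ℝ (e i) x ^ 2 := by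
    rw [← real_inner_self_eq_norm_sq, he.inner_sum]
    exact Finset.sum_congr rfl fun i _ => by simp [sq]
  rw [norm_sub_sq_real, h1, h2]
  ring

/-- A vector that attains equality in Bessel's inequality is the sum of its expansion. -/
theorem hasSum_of_norm_sq_le {I : Type*} {e : I → E} (he : Orthonormal ℝ e) {x : E}
    (hx : ENNReal.ofReal (‖x‖ ^ 2) ≤ ∑' i, ENNReal.ofReal (inner ℝ (e i) x ^ 2)) :
    HasSum (fun i => inner ℝ (e i) x • e i) x := by
  have hs : Summable fun i => inner ℝ (e i) x ^ 2 := by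
    simpa using he.inner_products_summable x
  have hle : ‖x‖ ^ 2 ≤ ∑' i, inner ℝ (e i) x ^ 2 := by
    rwa [← ENNReal.ofReal_tsum_of_nonneg (fun i => sq_nonneg _) hs,
      ENNReal.ofReal_le_ofReal_iff (tsum_nonneg fun i => sq_nonneg _)] at hx
  have hge : ∑' i, inner ℝ (e i) x ^ 2 ≤ ‖x‖ ^ 2 := by
    simpa using he.tsum_inner_products_le (x := x)
  have hlim : Tendsto (fun s : Finset I => ‖x - ∑ i ∈ s, inner ℝ (e i) x • e i‖ ^ 2) atTop
      (𝓝 0) := by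
    simp_rw [norm_sub_sum_inner_sq he]
    have := (tendsto_const_nhds (x := ‖x‖ ^ 2)).sub hs.hasSum
    rwa [le_antisymm hge hle, sub_self] at this
  rw [HasSum, SummationFilter.unconditional_filter, tendsto_iff_norm_sub_tendsto_zero]
  have := (Real.continuous_sqrt.tendsto 0).comp hlim
  simp only [Real.sqrt_zero] at this
  refine this.congr fun s => ?_
  simp only [Function.comp]
  rw [Real.sqrt_sq (norm_nonneg _), norm_sub_rev]

/-- Pair the expansion with `x` term by term; this form of Parseval does not need `e` to be
orthonormal or complete. -/
theorem norm_sq_eq_tsum_of_hasSum {I : Type*} {e : I → E} {x : E}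
    (hx : HasSum (fun i => inner ℝ (e i) x • e i) x) :
    ENNReal.ofReal (‖x‖ ^ 2) = ∑' i, ENNReal.ofReal (inner ℝ (e i) x ^ 2) := by
  have h := hx.mapL (innerSL ℝ x)
  have h' : HasSum (fun i => inner ℝ (e i) x ^ 2) (‖x‖ ^ 2) := by
    rw [← real_inner_self_eq_norm_sq]
    refine h.congr_fun fun i => ?_
    simp [real_inner_comm, sq]
  rw [← h'.tsum_eq, ENNReal.ofReal_tsum_of_nonneg (fun i => sq_nonneg _) h'.summable]

/-- By symmetry an eigenvector for `r` is orthogonal to every `b i` with `μ i ≠ r`. Its expansion is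
therefore a finite sum, and the eigenspaces for `r ≥ t` span exactly what the `b i` with `μ i ≥ t`
span. -/
theorem rank_iSup_eigenspace {I : Type*} (S : E →L[ℝ] E) (b : HilbertBasis I ℝ E) (μ : I → ℝ)
    (hsym : (S : E →ₗ[ℝ] E).IsSymmetric)
    (hb : ∀ i, S (b i) = μ i • b i) (t : ℝ) (hfin : {i | t ≤ μ i}.Finite) :
    Module.rank ℝ (⨆ (r : ℝ) (_ : t ≤ r), Module.End.eigenspace (S : E →ₗ[ℝ] E) r :
      Submodule ℝ E) = ({i | t ≤ μ i}.ncard : Cardinal) := by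
  have hspan : (⨆ (r : ℝ) (_ : t ≤ r), Module.End.eigenspace (S : E →ₗ[ℝ] E) r :
      Submodule ℝ E) = Submodule.span ℝ (range fun i : {i | t ≤ μ i} => b i) := by
    apply le_antisymm
    · refine iSup₂_le fun r hr y hy => ?_
      have hy' : S y = r • y := Module.End.mem_eigenspace_iff.1 hy
      have hcoef : ∀ i, μ i ≠ r → inner ℝ (b i) y = 0 := by
        intro i hi
        have h := hsym (b i) y
        have h' : μ i * inner ℝ (b i) y = r * inner ℝ (b i) y := by
          simpa [hb, hy', inner_smul_left, inner_smul_right] using h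
        have : (μ i - r) * inner ℝ (b i) y = 0 := by rw [sub_mul, h', sub_self]
        exact (mul_eq_zero.1 this).resolve_left (sub_ne_zero.2 hi)
      have hsum : HasSum (fun i => inner ℝ (b i) y • b i) y := by
        simpa [HilbertBasis.repr_apply_apply] using b.hasSum_repr y
      have hfs : HasSum (fun i => inner ℝ (b i) y • b i)
          (∑ i ∈ hfin.toFinset, inner ℝ (b i) y • b i) := by
        refine hasSum_sum_of_ne_finset_zero fun i hi => ?_
        rw [hcoef i, zero_smul]
        rintro rfl
        exact hi (by simpa using hr)
      rw [hsum.unique hfs]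
      refine Submodule.sum_mem _ fun i hi => Submodule.smul_mem _ _ (Submodule.subset_span ?_)
      exact ⟨⟨i, by simpa using hi⟩, rfl⟩
    · rw [Submodule.span_le]
      rintro _ ⟨i, rfl⟩
      have hmem : b i ∈ Module.End.eigenspace (S : E →ₗ[ℝ] E) (μ i) :=
        Module.End.mem_eigenspace_iff.2 (hb i)
      exact (le_iSup₂ (f := fun (r : ℝ) (_ : t ≤ r) =>
        Module.End.eigenspace (S : E →ₗ[ℝ] E) r) (μ i) i.2) hmem
  have hli : LinearIndependent ℝ fun i : {i | t ≤ μ i} => b i :=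
    (b.orthonormal.comp _ Subtype.val_injective).linearIndependent
  have hrange : (range fun i : {i | t ≤ μ i} => b i) = b '' {i | t ≤ μ i} := by
    ext y
    simp
  have hinj : Function.Injective b := b.orthonormal.linearIndependent.injective
  rw [hspan, rank_span hli, hrange, ← Set.cast_ncard (hfin.image b),
    Set.ncard_image_of_injective _ hinj]

variable [CompleteSpace F]

/-- Hilbert–Schmidt operators are compact. -/
theorem isCompactOperator_of_sum_norm_sq_le (T : E →L[ℝ] F) (B : ℝ)
    (hB : ∀ (n : ℕ) (e : Fin n → E), Orthonormal ℝ e → ∑ i, ‖T (e i)‖ ^ 2 ≤ B) :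
    IsCompactOperator T := by
  let A : Set ℝ := {r | ∃ (n : ℕ) (e : Fin n → E), Orthonormal ℝ e ∧ r = ∑ i, ‖T (e i)‖ ^ 2}
  have hbdd : BddAbove A := ⟨B, by rintro _ ⟨n, e, he, rfl⟩; exact hB n e he⟩
  have hne : A.Nonempty := ⟨0, 0, Fin.elim0, ⟨fun i => i.elim0, fun i => i.elim0⟩, by simp⟩
  -- Approximate `T` by its restriction to the span of a finite orthonormal family whose sum of
  -- squares is within `ε²` of the supremum. A unit vector `z` orthogonal to the family can be
  -- appended to it, so `‖T z‖² ≤ ε²`.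
  have key : ∀ ε : ℝ, 0 < ε → ∃ S : E →L[ℝ] F, IsCompactOperator S ∧ ‖T - S‖ ≤ ε := by
    intro ε hε
    obtain ⟨_, ⟨n, e, he, rfl⟩, hlt⟩ :=
      exists_lt_of_lt_csSup hne (sub_lt_self (sSup A) (pow_pos hε 2))
    let V : Submodule ℝ E := Submodule.span ℝ (range e)
    have : FiniteDimensional ℝ V := FiniteDimensional.span_of_finite ℝ (finite_range e)
    have : ProperSpace V := FiniteDimensional.proper ℝ V
    have hperp : ∀ y ∈ Vᗮ, ‖T y‖ ≤ ε * ‖y‖ := by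
      intro y hy
      rcases eq_or_ne y 0 with rfl | hy0
      · simp
      have hny : 0 < ‖y‖ := norm_pos_iff.2 hy0
      set z : E := ‖y‖⁻¹ • y with hz
      have hnz : ‖z‖ = 1 := by
        rw [hz, norm_smul, norm_inv, norm_norm, inv_mul_cancel₀ hny.ne']
      have hzV : z ∈ Vᗮ := Vᗮ.smul_mem _ hy
      have hez : ∀ i, inner ℝ (e i) z = 0 := fun i =>
        (Submodule.mem_orthogonal V z).1 hzV _ (Submodule.subset_span ⟨i, rfl⟩)
      have horth : Orthonormal ℝ (Fin.cons z e : Fin (n + 1) → E) := by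
        refine ⟨fun i => ?_, fun i j hij => ?_⟩
        · refine Fin.cases ?_ (fun i => ?_) i
          · simpa using hnz
          · simpa using he.1 i
        · revert hij
          refine Fin.cases ?_ (fun i => ?_) i <;> refine Fin.cases ?_ (fun j => ?_) j
          · intro h; exact absurd rfl h
          · intro _; simpa [real_inner_comm] using hez j
          · intro _; simpa using hez i
          · intro h; simpa using he.2 (fun h' => h (by rw [h']))
      have hle : ∑ i, ‖T ((Fin.cons z e : Fin (n + 1) → E) i)‖ ^ 2 ≤ sSup A :=
        le_csSup hbdd ⟨_, _, horth, rfl⟩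
      rw [Fin.sum_univ_succ] at hle
      simp only [Fin.cons_zero, Fin.cons_succ] at hle
      have hTz : ‖T z‖ ≤ ε := by
        refine le_of_sq_le_sq ?_ hε.le
        linarith
      have hyz : y = ‖y‖ • z := by rw [hz, smul_smul, mul_inv_cancel₀ hny.ne', one_smul]
      calc ‖T y‖ = ‖y‖ * ‖T z‖ := by
            conv_lhs => rw [hyz]
            rw [map_smul, norm_smul, norm_norm]
        _ ≤ ε * ‖y‖ := by rw [mul_comm]; exact mul_le_mul_of_nonneg_right hTz hny.le
    refine ⟨(T.comp V.subtypeL).comp V.orthogonalProjectionOnto, ?_, ?_⟩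
    · exact (isCompactOperator_of_locallyCompactSpace_rng (T.comp V.subtypeL)).comp_clm
        V.orthogonalProjectionOnto
    · refine ContinuousLinearMap.opNorm_le_bound _ hε.le fun x => ?_
      have hx : (T - (T.comp V.subtypeL).comp V.orthogonalProjectionOnto) x =
          T (x - V.orthogonalProjectionOnto x) := by simp
      rw [hx]
      refine (hperp _ (V.sub_starProjection_mem_orthogonal x)).trans
        (mul_le_mul_of_nonneg_left ?_ hε.le)
      have := Vᗮ.norm_starProjection_apply_le x
      rwa [Submodule.starProjection_orthogonal_val] at this
  have hcl := isClosed_setOfPred_isCompactOperator (𝕜₁ := ℝ) (𝕜₂ := ℝ) (σ₁₂ := RingHom.id ℝ)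
    (M₁ := E) (M₂ := F)
  have hmem : T ∈ closure {f : E →L[ℝ] F | IsCompactOperator f} := by
    refine Metric.mem_closure_iff.2 fun ε hε => ?_
    obtain ⟨S, hS, hTS⟩ := key (ε / 2) (by linarith)
    exact ⟨S, hS, by rw [dist_eq_norm]; linarith⟩
  rw [hcl.closure_eq] at hmem
  exact hmem

variable [CompleteSpace E]

/-- A compact self-adjoint operator has a Hilbert basis of eigenvectors, which may be chosen to
contain a given unit eigenvector. -/
theorem exists_eigenbasis (S : E →L[ℝ] E) (hS : IsCompactOperator S)
    (hsym : (S : E →ₗ[ℝ] E).IsSymmetric) (x : E) (hx : ‖x‖ = 1) (r : ℝ) (hxr : S x = r • x) :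
    ∃ (I : Type u) (b : HilbertBasis I ℝ E) (μ : I → ℝ), (∀ i, S (b i) = μ i • b i) ∧
      ∃ i, b i = x := by
  let G : ℝ → Submodule ℝ E := fun μ => Module.End.eigenspace (S : E →ₗ[ℝ] E) μ
  have hG : ∀ μ (y : E), y ∈ G μ ↔ S y = μ • y := fun μ y => Module.End.mem_eigenspace_iff
  have hcl : ∀ μ, IsClosed (G μ : Set E) := fun μ => by
    have : (G μ : Set E) = {y | S y = μ • y} := Set.ext fun y => hG μ y
    rw [this]
    exact isClosed_eq S.continuous (continuous_const_smul μ)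
  have : ∀ μ, CompleteSpace (G μ) := fun μ => (hcl μ).completeSpace_coe
  -- The set of copies of `x` in an eigenspace is empty or a single unit vector, hence orthonormal,
  -- and extends to a basis of that eigenspace.
  have hex : ∀ μ, ∃ (w : Set (G μ)) (b : HilbertBasis w ℝ (G μ)),
      {y : G μ | (y : E) = x} ⊆ w ∧ ⇑b = ((↑) : w → G μ) := by
    intro μ
    refine Orthonormal.exists_hilbertBasis_extension ?_
    refine ⟨fun y => ?_, fun y z hyz => absurd ?_ hyz⟩
    · have h := y.2
      simp only [Set.mem_ofPred_eq] at h
      rw [Submodule.coe_norm, h, hx]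
    · exact Subtype.ext (Subtype.ext (y.2.trans z.2.symm))
  choose w b hw hb using hex
  have hfam := hsym.orthogonalFamily_eigenspaces
  let v : (Σ μ : ℝ, w μ) → E := fun i => ((b i.1 i.2 : G i.1) : E)
  have hv : Orthonormal ℝ v :=
    hfam.orthonormal_sigma_orthonormal (v_family := fun μ => b μ) fun μ => (b μ).orthonormal
  have hbot : (Submodule.span ℝ (range v))ᗮ = ⊥ := by
    rw [eq_bot_iff, ← ContinuousLinearMap.orthogonalComplement_iSup_eigenspaces_eq_bot hS hsym]
    intro z hz
    rw [Submodule.mem_orthogonal] at hz ⊢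
    have hz' : ∀ μ, ∀ y ∈ G μ, inner ℝ y z = 0 := by
      intro μ y hy
      have hsum := ((b μ).hasSum_repr ⟨y, hy⟩).mapL ((innerSL ℝ z).comp (G μ).subtypeL)
      have hzero : (fun i => ((innerSL ℝ z).comp (G μ).subtypeL)
          ((b μ).repr ⟨y, hy⟩ i • b μ i)) = fun _ => 0 := by
        funext i
        have := hz _ (Submodule.subset_span ⟨⟨μ, i⟩, rfl⟩)
        rw [real_inner_comm] at this
        simp only [map_smul, smul_eq_mul]
        exact mul_eq_zero_of_right _ this
      rw [hzero] at hsum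
      have := hsum.unique hasSum_zero
      rw [real_inner_comm]
      exact this
    intro y hy
    refine Submodule.iSup_induction _ (motive := fun y => inner ℝ y z = 0) hy hz' (by simp) ?_
    intro y y' h h'
    rw [inner_add_left, h, h', add_zero]
  refine ⟨Σ μ : ℝ, w μ, HilbertBasis.mkOfOrthogonalEqBot hv hbot, fun i => i.1, fun i => ?_, ?_⟩
  · rw [HilbertBasis.coe_mkOfOrthogonalEqBot]
    exact (hG _ _).1 (b i.1 i.2 : G i.1).2
  · have hxG : x ∈ G r := (hG r x).2 hxr
    refine ⟨⟨r, ⟨⟨x, hxG⟩, hw r rfl⟩⟩, ?_⟩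
    rw [HilbertBasis.coe_mkOfOrthogonalEqBot]
    simp [v, hb]

/-- The rank in the definition of `singularValue` is the number of `i` with `s ≤ σ i`, so the two
suprema run over the same set. -/
theorem singularValue_eq_rearr {I : Type*} (T : E →L[ℝ] F) (b : HilbertBasis I ℝ E) (σ : I → ℝ)
    (h0 : ∀ i, 0 ≤ σ i)
    (hb : ∀ i, ((ContinuousLinearMap.adjoint T).comp T) (b i) = σ i ^ 2 • b i)
    (hfin : ∀ s : ℝ, 0 < s → {i | s ≤ σ i}.Finite) (k : ℕ) :
    singularValue T k = rearr σ k := by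
  have hsym : (((ContinuousLinearMap.adjoint T).comp T : E →L[ℝ] E) : E →ₗ[ℝ] E).IsSymmetric := by
    intro x y
    simp [ContinuousLinearMap.adjoint_inner_left, ContinuousLinearMap.adjoint_inner_right]
  unfold singularValue rearr
  congr 2
  ext s
  refine and_congr_right fun hs => ?_
  have hset : {i | s ^ 2 ≤ σ i ^ 2} = {i | s ≤ σ i} := by
    ext i
    exact pow_le_pow_iff_left₀ hs.le (h0 i) two_ne_zero
  rw [rank_iSup_eigenspace _ b (fun i => σ i ^ 2) hsym hb _ (hset ▸ hfin s hs), hset]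
  exact Nat.cast_le

/-- Singular vectors of a Hilbert–Schmidt contraction that preserves the norm of `x`. -/
theorem exists_singular_vectors (T : E →L[ℝ] F) {B : ℝ≥0∞} (hB : B ≠ ∞)
    (hT : ∀ {I : Type u} (b : HilbertBasis I ℝ E), ∑' i, ENNReal.ofReal (‖T (b i)‖ ^ 2) = B)
    (hnorm : ∀ y, ‖T y‖ ≤ ‖y‖) (x : E) (hx : ‖x‖ = 1)
    (hTx : ContinuousLinearMap.adjoint T (T x) = x) :
    Antitone (singularValue T) ∧ (∀ k, 0 ≤ singularValue T k) ∧ singularValue T 0 = 1 ∧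
    ∑' k, ENNReal.ofReal (singularValue T k ^ 2) = B ∧
    ∃ ψ : {k // singularValue T k ≠ 0} → E, Orthonormal ℝ ψ ∧
      (∀ k, ContinuousLinearMap.adjoint T (T (ψ k)) = singularValue T k ^ 2 • ψ k) ∧
      ∀ h : singularValue T 0 ≠ 0, ψ ⟨0, h⟩ = x := by
  classical
  have hcomp : IsCompactOperator T := by
    refine isCompactOperator_of_sum_norm_sq_le T B.toReal fun n e he => ?_
    obtain ⟨w, b, hw, hb⟩ := he.toSubtypeRange.exists_hilbertBasis_extension
    have h := hT b
    have hle : ∑ i, ENNReal.ofReal (‖T (e i)‖ ^ 2) ≤ B := by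
      rw [← h, ← tsum_fintype (L := .unconditional _)]
      refine le_trans (le_of_eq (tsum_congr fun i => ?_))
        (ENNReal.tsum_comp_le_tsum_of_injective (f := fun i : Fin n => (⟨e i, hw ⟨i, rfl⟩⟩ : w))
          ?_ _)
      · rw [hb]
      · intro i j hij
        exact he.linearIndependent.injective (congrArg Subtype.val hij)
    rw [← ENNReal.ofReal_sum_of_nonneg fun i _ => sq_nonneg _] at hle
    exact (ENNReal.ofReal_le_iff_le_toReal hB).1 hle
  set S : E →L[ℝ] E := (ContinuousLinearMap.adjoint T).comp T with hSdef
  have hsym : (S : E →ₗ[ℝ] E).IsSymmetric := by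
    intro y z
    simp [S, ContinuousLinearMap.adjoint_inner_left, ContinuousLinearMap.adjoint_inner_right]
  have hScomp : IsCompactOperator S :=
    hcomp.clm_comp (ContinuousLinearMap.adjoint T)
  obtain ⟨I, b, μ, hb, i₀, hi₀⟩ := exists_eigenbasis S hScomp hsym x hx 1 (by simpa [S] using hTx)
  have hμ : ∀ i, μ i = ‖T (b i)‖ ^ 2 := by
    intro i
    have h1 : inner ℝ (b i) (S (b i)) = μ i := by
      rw [hb, inner_smul_right, real_inner_self_eq_norm_sq, b.orthonormal.1 i]
      simp
    rw [← h1, ← real_inner_self_eq_norm_sq]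
    simp [S, ContinuousLinearMap.adjoint_inner_right]
  set σ : I → ℝ := fun i => ‖T (b i)‖ with hσ
  have hσ0 : ∀ i, 0 ≤ σ i := fun i => norm_nonneg _
  have hσ1 : ∀ i, σ i ≤ 1 := fun i => (hnorm _).trans_eq (b.orthonormal.1 i)
  have hfin : ∀ s : ℝ, 0 < s → {i | s ≤ σ i}.Finite := by
    intro s hs
    have hf := ENNReal.finite_const_le_of_tsum_ne_top (a := fun i => ENNReal.ofReal (‖T (b i)‖ ^ 2))
      (by rw [hT b]; exact hB) (ε := ENNReal.ofReal (s ^ 2)) (by simpa using hs.ne')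
    refine hf.subset fun i hi => ENNReal.ofReal_le_ofReal ?_
    exact pow_le_pow_left₀ hs.le hi 2
  have hsv : singularValue T = rearr σ := funext fun k =>
    singularValue_eq_rearr T b σ hσ0 (fun i => by rw [← hSdef, hb, hμ]) hfin k
  have hσi₀ : σ i₀ = 1 := by
    have h : ‖T x‖ ^ 2 = 1 := by
      rw [← real_inner_self_eq_norm_sq, ← ContinuousLinearMap.adjoint_inner_right, hTx,
        real_inner_self_eq_norm_sq, hx, one_pow]
    simp only [hσ, hi₀]
    nlinarith [norm_nonneg (T x)]
  have hr0 : rearr σ 0 = 1 := by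
    apply le_antisymm
    · refine csSup_le ⟨0, Or.inl rfl⟩ ?_
      rintro s (rfl | ⟨hs, hk⟩)
      · exact zero_le_one
      · obtain ⟨i, hi⟩ := Set.nonempty_of_ncard_ne_zero (by omega : {i | s ≤ σ i}.ncard ≠ 0)
        exact hi.trans (hσ1 i)
    · rw [le_rearr_iff hfin one_pos]
      have : 0 < {i | (1 : ℝ) ≤ σ i}.ncard := (Set.ncard_pos (hfin 1 one_pos)).2 ⟨i₀, hσi₀.ge⟩
      omega
  rw [hsv]
  obtain ⟨e₁, he₁⟩ := exists_rearr_equiv hfin hσ0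
  let k₀ : {k // rearr σ k ≠ 0} := ⟨0, by rw [hr0]; exact one_ne_zero⟩
  let j₀ : {i // σ i ≠ 0} := ⟨i₀, by rw [hσi₀]; exact one_ne_zero⟩
  -- The eigenvalue `1` may be multiple, so position `0` need not fall on `x`. The swap puts it
  -- there and preserves values, both being `1`.
  let e := e₁.trans (Equiv.swap (e₁ k₀) j₀)
  have he : ∀ k, σ (e k) = rearr σ k := by
    intro k
    rw [← he₁]
    simp only [e, Equiv.trans_apply]
    by_cases h1 : e₁ k = e₁ k₀
    · rw [h1, Equiv.swap_apply_left, he₁]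
      exact hσi₀.trans hr0.symm
    · by_cases h2 : e₁ k = j₀
      · rw [h2, Equiv.swap_apply_right, he₁]
        exact hr0.trans hσi₀.symm
      · rw [Equiv.swap_apply_of_ne_of_ne h1 h2]
  refine ⟨rearr_antitone hfin, rearr_nonneg hfin, hr0, ?_, fun k => b (e k), ?_, ?_, ?_⟩
  · rw [← hT b]
    have h1 : ∑' k : {k // rearr σ k ≠ 0}, ENNReal.ofReal (rearr σ k ^ 2) =
        ∑' k, ENNReal.ofReal (rearr σ k ^ 2) := by
      refine tsum_subtype_eq_of_support_subset (s := {k | rearr σ k ≠ 0})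
        (f := fun k => ENNReal.ofReal (rearr σ k ^ 2)) fun k hk => ?_
      intro h
      exact hk (by simp [h])
    have h2 : ∑' i : {i // σ i ≠ 0}, ENNReal.ofReal (σ i ^ 2) =
        ∑' i, ENNReal.ofReal (σ i ^ 2) := by
      refine tsum_subtype_eq_of_support_subset (s := {i | σ i ≠ 0})
        (f := fun i => ENNReal.ofReal (σ i ^ 2)) fun i hi => ?_
      intro h
      exact hi (by simp [h])
    rw [← h1, ← h2, ← e.tsum_eq]
    exact tsum_congr fun k => by rw [he]
  · exact b.orthonormal.comp _ (Subtype.val_injective.comp e.injective)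
  · intro k
    have := hb (e k)
    rw [hμ] at this
    rw [← he]
    exact this
  · intro h
    have : e ⟨0, h⟩ = j₀ := by simp [e, k₀]
    simp only [this]
    exact hi₀

end Hilbert

theorem hasSum_inner_smul {I E : Type*} [NormedAddCommGroup E] [InnerProductSpace ℝ E]
    (b : HilbertBasis I ℝ E) (x : E) : HasSum (fun i => inner ℝ (b i) x • b i) x := by
  simpa [HilbertBasis.repr_apply_apply] using b.hasSum_repr x

/-! ### Tensor products in `L²(μ ⊗ ν)` -/

section TensorProduct

variable {X : Type u} {Y : Type v} [MeasurableSpace X] [MeasurableSpace Y]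

theorem memLp_two_mul_prod {μ : Measure X} {ν : Measure Y} [SFinite μ] [SFinite ν] {g : X → ℝ}
    {h : Y → ℝ} (hg : MemLp g 2 μ) (hh : MemLp h 2 ν) :
    MemLp (fun p : X × Y => g p.1 * h p.2) 2 (μ.prod ν) := by
  have hm : AEStronglyMeasurable (fun p : X × Y => g p.1 * h p.2) (μ.prod ν) :=
    hg.1.comp_fst.mul hh.1.comp_snd
  rw [memLp_two_iff_integrable_sq hm]
  simpa only [mul_pow] using hg.integrable_sq.mul_prod hh.integrable_sq

theorem ae_comp_fst {μ : Measure X} {ν : Measure Y} [SFinite ν] {f f' : X → ℝ} (h : f =ᵐ[μ] f') :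
    (fun p : X × Y => f p.1) =ᵐ[μ.prod ν] fun p => f' p.1 :=
  Measure.quasiMeasurePreserving_fst.ae_eq_comp h

theorem ae_comp_snd {μ : Measure X} {ν : Measure Y} [SFinite ν] {f f' : Y → ℝ} (h : f =ᵐ[ν] f') :
    (fun p : X × Y => f p.2) =ᵐ[μ.prod ν] fun p => f' p.2 :=
  Measure.quasiMeasurePreserving_snd.ae_eq_comp h

variable {μ : Measure X} {ν : Measure Y} [IsProbabilityMeasure μ] [IsProbabilityMeasure ν]

/-- The function `g(x) h(y)` as an element of `L²(μ ⊗ ν)`. -/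
noncomputable def tensorLp (g : Lp ℝ 2 μ) (h : Lp ℝ 2 ν) : Lp ℝ 2 (μ.prod ν) :=
  (memLp_two_mul_prod (Lp.memLp g) (Lp.memLp h)).toLp _

theorem tensorLp_coeFn (g : Lp ℝ 2 μ) (h : Lp ℝ 2 ν) :
    tensorLp g h =ᵐ[μ.prod ν] fun p => g p.1 * h p.2 := MemLp.coeFn_toLp _

theorem inner_tensorLp (g g' : Lp ℝ 2 μ) (h h' : Lp ℝ 2 ν) :
    inner ℝ (tensorLp g h) (tensorLp g' h') = inner ℝ g g' * inner ℝ h h' := by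
  simp_rw [L2.inner_def]
  rw [← integral_prod_mul]
  refine integral_congr_ae ?_
  filter_upwards [tensorLp_coeFn g h, tensorLp_coeFn g' h'] with p h1 h2
  simp only [h1, h2, RCLike.inner_apply, conj_trivial]
  ring

theorem norm_tensorLp (g : Lp ℝ 2 μ) (h : Lp ℝ 2 ν) : ‖tensorLp g h‖ = ‖g‖ * ‖h‖ := by
  have := inner_tensorLp g g h h
  simp_rw [real_inner_self_eq_norm_sq] at this
  rw [← mul_pow] at this
  exact (sq_eq_sq₀ (norm_nonneg _) (by positivity)).1 this

variable (μ ν) in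
/-- The tensor product as a continuous bilinear map. -/
noncomputable def tensorCLM : Lp ℝ 2 μ →L[ℝ] Lp ℝ 2 ν →L[ℝ] Lp ℝ 2 (μ.prod ν) :=
  LinearMap.mkContinuous₂ (LinearMap.mk₂ ℝ tensorLp
    (fun g g' h => by
      ext1
      filter_upwards [tensorLp_coeFn (g + g') h, tensorLp_coeFn g h, tensorLp_coeFn g' h,
        ae_comp_fst (ν := ν) (Lp.coeFn_add g g'), Lp.coeFn_add (tensorLp g h) (tensorLp g' h)]
        with p h1 h2 h3 h4 h5
      simp only [h1, h5, Pi.add_apply, h2, h3, h4]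
      ring)
    (fun c g h => by
      ext1
      filter_upwards [tensorLp_coeFn (c • g) h, tensorLp_coeFn g h,
        ae_comp_fst (ν := ν) (Lp.coeFn_smul c g), Lp.coeFn_smul c (tensorLp g h)]
        with p h1 h2 h3 h4
      simp only [h1, h4, Pi.smul_apply, h2, h3, smul_eq_mul]
      ring)
    (fun g h h' => by
      ext1
      filter_upwards [tensorLp_coeFn g (h + h'), tensorLp_coeFn g h, tensorLp_coeFn g h',
        ae_comp_snd (μ := μ) (Lp.coeFn_add h h'), Lp.coeFn_add (tensorLp g h) (tensorLp g h')]
        with p h1 h2 h3 h4 h5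
      simp only [h1, h5, Pi.add_apply, h2, h3, h4]
      ring)
    (fun c g h => by
      ext1
      filter_upwards [tensorLp_coeFn g (c • h), tensorLp_coeFn g h,
        ae_comp_snd (μ := μ) (Lp.coeFn_smul c h), Lp.coeFn_smul c (tensorLp g h)]
        with p h1 h2 h3 h4
      simp only [h1, h4, Pi.smul_apply, h2, h3, smul_eq_mul]
      ring)) 1 fun g h => by
        rw [LinearMap.mk₂_apply, norm_tensorLp, one_mul]

theorem eq_zero_of_forall_setIntegral_prod {z : X × Y → ℝ} (hz : Integrable z (μ.prod ν))
    (h : ∀ (A : Set X) (B : Set Y), MeasurableSet A → MeasurableSet B →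
      ∫ p in A ×ˢ B, z p ∂μ.prod ν = 0) : z =ᵐ[μ.prod ν] 0 := by
  refine hz.ae_eq_zero_of_forall_setIntegral_eq_zero fun s hs _ => ?_
  induction s, hs using MeasurableSpace.induction_on_inter generateFrom_prod.symm
    isPiSystem_prod with
  | empty => simp
  | basic s hs =>
    obtain ⟨A, hA, B, hB, rfl⟩ := hs
    exact h A B hA hB
  | compl s hs ih =>
    have huniv : ∫ p, z p ∂μ.prod ν = 0 := by
      have := h univ univ MeasurableSet.univ MeasurableSet.univ
      rwa [univ_prod_univ, setIntegral_univ] at this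
    have hadd := integral_add_compl hs hz
    rw [ih (measure_lt_top _ _), huniv, zero_add] at hadd
    exact hadd
  | iUnion f hd hf ih =>
    rw [integral_iUnion hf hd hz.integrableOn]
    simp [fun i => ih i (measure_lt_top _ _)]

/-- Indicators of rectangles are tensors, and an integrable function with zero integral over every
rectangle vanishes. -/
theorem eq_zero_of_forall_inner_tensorLp {z : Lp ℝ 2 (μ.prod ν)}
    (h : ∀ (g : Lp ℝ 2 μ) (h : Lp ℝ 2 ν), inner ℝ (tensorLp g h) z = 0) : z = 0 := by
  refine (Lp.eq_zero_iff_ae_eq_zero).2 (eq_zero_of_forall_setIntegral_prod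
    ((Lp.memLp z).integrable one_le_two) fun A B hA hB => ?_)
  have h1 := h (indicatorConstLp 2 hA (measure_ne_top _ _) 1)
    (indicatorConstLp 2 hB (measure_ne_top _ _) 1)
  rw [L2.inner_def] at h1
  rw [← h1, ← integral_indicator (hA.prod hB)]
  refine integral_congr_ae ?_
  filter_upwards [tensorLp_coeFn (indicatorConstLp 2 hA (measure_ne_top μ _) (1 : ℝ))
    (indicatorConstLp 2 hB (measure_ne_top ν _) (1 : ℝ)),
    ae_comp_fst (ν := ν) (indicatorConstLp_coeFn (p := 2) (hs := hA)
      (hμs := measure_ne_top μ _) (c := (1 : ℝ))),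
    ae_comp_snd (μ := μ) (indicatorConstLp_coeFn (p := 2) (hs := hB)
      (hμs := measure_ne_top ν _) (c := (1 : ℝ)))] with p h2 h3 h4
  rw [h2, h3, h4]
  by_cases hpA : p.1 ∈ A <;> by_cases hpB : p.2 ∈ B <;> simp [indicator, hpA, hpB]

/-- Tensor products of Hilbert bases form a Hilbert basis. -/
theorem exists_tensor_hilbertBasis {I J : Type*} (c : HilbertBasis J ℝ (Lp ℝ 2 μ))
    (b : HilbertBasis I ℝ (Lp ℝ 2 ν)) :
    ∃ e : HilbertBasis (I × J) ℝ (Lp ℝ 2 (μ.prod ν)), ∀ i, e i = tensorLp (c i.2) (b i.1) := by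
  classical
  have horth : Orthonormal ℝ fun i : I × J => tensorLp (c i.2) (b i.1) := by
    rw [orthonormal_iff_ite]
    intro i j
    rw [inner_tensorLp, orthonormal_iff_ite.1 c.orthonormal, orthonormal_iff_ite.1 b.orthonormal]
    by_cases h1 : i.1 = j.1 <;> by_cases h2 : i.2 = j.2 <;> simp [h1, h2, Prod.ext_iff]
  have hbot : (Submodule.span ℝ (range fun i : I × J => tensorLp (c i.2) (b i.1)))ᗮ = ⊥ := by
    rw [eq_bot_iff]
    intro z hz
    rw [Submodule.mem_orthogonal] at hz
    have hz0 : ∀ j i, inner ℝ (tensorLp (c j) (b i)) z = 0 := fun j i =>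
      hz _ (Submodule.subset_span ⟨(i, j), rfl⟩)
    -- Orthogonality to the tensors of basis vectors extends, by continuity of the tensor product,
    -- first in the second factor and then in the first.
    have hz1 : ∀ j h, inner ℝ (tensorLp (c j) h) z = 0 := by
      intro j h
      have hsum := (b.hasSum_repr h).mapL ((innerSL ℝ z).comp (tensorCLM μ ν (c j)))
      have hzero : (fun i => ((innerSL ℝ z).comp (tensorCLM μ ν (c j))) (b.repr h i • b i)) =
          fun _ => 0 := by
        funext i
        rw [map_smul, smul_eq_mul]
        refine mul_eq_zero_of_right _ ?_
        have := hz0 j i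
        rw [real_inner_comm] at this
        exact this
      rw [hzero] at hsum
      rw [real_inner_comm]
      exact hsum.unique hasSum_zero
    refine eq_zero_of_forall_inner_tensorLp fun g h => ?_
    have hsum := (c.hasSum_repr g).mapL ((innerSL ℝ z).comp ((tensorCLM μ ν).flip h))
    have hzero : (fun j => ((innerSL ℝ z).comp ((tensorCLM μ ν).flip h)) (c.repr g j • c j)) =
        fun _ => 0 := by
      funext j
      rw [map_smul, smul_eq_mul]
      refine mul_eq_zero_of_right _ ?_
      have := hz1 j h
      rw [real_inner_comm] at this
      exact this
    rw [hzero] at hsum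
    rw [real_inner_comm]
    exact hsum.unique hasSum_zero
  exact ⟨HilbertBasis.mkOfOrthogonalEqBot horth hbot, fun i => by
    rw [HilbertBasis.coe_mkOfOrthogonalEqBot]⟩

end TensorProduct

/-! ### The likelihood operator and its singular value decomposition -/

section Likelihood

variable {X : Type u} {Y : Type v} [MeasurableSpace X] [MeasurableSpace Y]
  (P : Measure (X × Y))

theorem liftFst_coeFn (g : Lp ℝ 2 P.fst) : liftFst P g =ᵐ[P] fun p => g p.1 :=
  Lp.coeFn_compMeasurePreserving g ⟨measurable_fst, rfl⟩

theorem liftSnd_coeFn (h : Lp ℝ 2 P.snd) : liftSnd P h =ᵐ[P] fun p => h p.2 :=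
  Lp.coeFn_compMeasurePreserving h ⟨measurable_snd, rfl⟩

theorem absolutelyContinuous_of_chiSqInfo_ne_top {P : Measure (X × Y)} (hP : chiSqInfo P ≠ ∞) :
    P ≪ P.fst.prod P.snd := by
  by_contra h
  exact hP (by rw [chiSqInfo, chiSq, if_neg h])

theorem inner_likelihoodOp (g : Lp ℝ 2 P.fst) (h : Lp ℝ 2 P.snd) :
    inner ℝ g (likelihoodOp P h) = ∫ p, g p.1 * h p.2 ∂P := by
  rw [likelihoodOp, ContinuousLinearMap.comp_apply, ContinuousLinearMap.adjoint_inner_right,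
    L2.inner_def]
  refine integral_congr_ae ?_
  filter_upwards [liftFst_coeFn P g, liftSnd_coeFn P h] with p h1 h2
  rw [h1, h2, RCLike.inner_apply, conj_trivial, mul_comm]

theorem norm_likelihoodOp_le (h : Lp ℝ 2 P.snd) : ‖likelihoodOp P h‖ ≤ ‖h‖ := by
  have h1 : ‖ContinuousLinearMap.adjoint (liftFst P)‖ ≤ 1 := by
    rw [LinearIsometryEquiv.norm_map]
    exact LinearIsometry.norm_toContinuousLinearMap_le _
  have h2 : ‖liftSnd P h‖ = ‖h‖ := LinearIsometry.norm_map _ h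
  calc ‖likelihoodOp P h‖ ≤ ‖ContinuousLinearMap.adjoint (liftFst P)‖ * ‖liftSnd P h‖ :=
        (ContinuousLinearMap.adjoint (liftFst P)).le_opNorm (liftSnd P h)
    _ ≤ 1 * ‖liftSnd P h‖ := mul_le_mul_of_nonneg_right h1 (norm_nonneg _)
    _ = ‖h‖ := by rw [one_mul, h2]

variable [IsProbabilityMeasure P]

/-- The constant function `1` in `L²`. -/
noncomputable def oneLp {Ω : Type*} [MeasurableSpace Ω] (μ : Measure Ω) [IsFiniteMeasure μ] :
    Lp ℝ 2 μ := (memLp_const (1 : ℝ)).toLp _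

theorem oneLp_coeFn {Ω : Type*} [MeasurableSpace Ω] (μ : Measure Ω) [IsFiniteMeasure μ] :
    oneLp μ =ᵐ[μ] fun _ => 1 := MemLp.coeFn_toLp _

theorem inner_oneLp {Ω : Type*} [MeasurableSpace Ω] (μ : Measure Ω) [IsFiniteMeasure μ]
    (g : Lp ℝ 2 μ) : inner ℝ g (oneLp μ) = ∫ x, g x ∂μ := by
  rw [L2.inner_def]
  refine integral_congr_ae ?_
  filter_upwards [oneLp_coeFn μ] with x hx
  simp [hx]

theorem norm_oneLp {Ω : Type*} [MeasurableSpace Ω] (μ : Measure Ω) [IsProbabilityMeasure μ] :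
    ‖oneLp μ‖ = 1 := by
  have h := inner_oneLp μ (oneLp μ)
  rw [real_inner_self_eq_norm_sq, integral_congr_ae (oneLp_coeFn μ)] at h
  have h1 : ‖oneLp μ‖ ^ 2 = 1 ^ 2 := by simpa using h
  exact (sq_eq_sq₀ (norm_nonneg _) zero_le_one).1 h1

theorem likelihoodOp_one : likelihoodOp P (oneLp P.snd) = oneLp P.fst := by
  refine ext_inner_left ℝ fun g => ?_
  rw [inner_likelihoodOp, inner_oneLp]
  have h1 : ∫ p, g p.1 * oneLp P.snd p.2 ∂P = ∫ p, g p.1 ∂P := by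
    refine integral_congr_ae ?_
    filter_upwards [ae_of_ae_map measurable_snd.aemeasurable (oneLp_coeFn P.snd)] with p hp
    rw [hp, mul_one]
  rw [h1]
  exact (integral_map measurable_fst.aemeasurable (Lp.aestronglyMeasurable g)).symm

theorem adjoint_likelihoodOp_one :
    ContinuousLinearMap.adjoint (likelihoodOp P) (oneLp P.fst) = oneLp P.snd := by
  refine ext_inner_left ℝ fun h => ?_
  rw [ContinuousLinearMap.adjoint_inner_right, real_inner_comm, inner_likelihoodOp, inner_oneLp]
  have h1 : ∫ p, oneLp P.fst p.1 * h p.2 ∂P = ∫ p, h p.2 ∂P := by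
    refine integral_congr_ae ?_
    filter_upwards [ae_of_ae_map measurable_fst.aemeasurable (oneLp_coeFn P.fst)] with p hp
    rw [hp, one_mul]
  rw [h1]
  exact (integral_map measurable_snd.aemeasurable (Lp.aestronglyMeasurable h)).symm

variable {P}

theorem memLp_rnDeriv (hP : chiSqInfo P ≠ ∞) :
    MemLp (fun p => (P.rnDeriv (P.fst.prod P.snd) p).toReal) 2 (P.fst.prod P.snd) := by
  have hm : Measurable fun p => (P.rnDeriv (P.fst.prod P.snd) p).toReal :=
    (Measure.measurable_rnDeriv _ _).ennreal_toReal
  have h1 : MemLp (fun p => (P.rnDeriv (P.fst.prod P.snd) p).toReal - 1) 2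
      (P.fst.prod P.snd) := by
    rw [memLp_two_iff_integrable_sq (hm.sub_const 1).aestronglyMeasurable]
    refine ⟨((hm.sub_const 1).pow_const 2).aestronglyMeasurable, ?_⟩
    rw [hasFiniteIntegral_iff_ofReal (ae_of_all _ fun p => sq_nonneg _)]
    rw [chiSqInfo, chiSq, if_pos (absolutelyContinuous_of_chiSqInfo_ne_top hP)] at hP
    exact hP.lt_top
  refine (h1.add (memLp_const (1 : ℝ))).ae_eq (ae_of_all _ fun p => ?_)
  simp

/-- The density has mean `1`, so its variance is its second moment minus `1`. -/
theorem chiSqInfo_add_one (hP : chiSqInfo P ≠ ∞) :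
    chiSqInfo P + 1 = ENNReal.ofReal
      (∫ p, (P.rnDeriv (P.fst.prod P.snd) p).toReal ^ 2 ∂P.fst.prod P.snd) := by
  have hac := absolutelyContinuous_of_chiSqInfo_ne_top hP
  have hL := memLp_rnDeriv hP
  set ℓ := fun p => (P.rnDeriv (P.fst.prod P.snd) p).toReal with hℓ
  have hone : ∫ p, ℓ p ∂P.fst.prod P.snd = 1 := by
    rw [hℓ, Measure.integral_toReal_rnDeriv hac]
    simp
  have hsq : Integrable (fun p => (ℓ p - 1) ^ 2) (P.fst.prod P.snd) :=
    (hL.sub (memLp_const 1)).integrable_sq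
  have hexpand : ∫ p, (ℓ p - 1) ^ 2 ∂P.fst.prod P.snd =
      ∫ p, ℓ p ^ 2 ∂P.fst.prod P.snd - 1 := by
    have hexp : ∀ p, (ℓ p - 1) ^ 2 = ℓ p ^ 2 - 2 * ℓ p + 1 := fun p => by ring
    simp_rw [hexp]
    have i1 : Integrable (fun p => 2 * ℓ p) (P.fst.prod P.snd) :=
      (hL.integrable one_le_two).const_mul 2
    have i2 : Integrable (fun p => ℓ p ^ 2 - 2 * ℓ p) (P.fst.prod P.snd) :=
      hL.integrable_sq.sub i1
    rw [integral_add i2 (integrable_const _),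
      integral_sub hL.integrable_sq i1, integral_const_mul, hone]
    simp
    ring
  rw [chiSqInfo, chiSq, if_pos hac,
    ← ofReal_integral_eq_lintegral_ofReal hsq (ae_of_all _ fun p => sq_nonneg _),
    ← ENNReal.ofReal_one, ← ENNReal.ofReal_add (integral_nonneg fun p => sq_nonneg _) zero_le_one]
  change ENNReal.ofReal (∫ p, (ℓ p - 1) ^ 2 ∂P.fst.prod P.snd + 1) = _
  rw [hexpand, sub_add_cancel]

/-- The Hilbert–Schmidt norm of the likelihood operator. -/
theorem tsum_norm_likelihoodOp_sq (hP : chiSqInfo P ≠ ∞) {I : Type v}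
    (b : HilbertBasis I ℝ (Lp ℝ 2 P.snd)) :
    ∑' i, ENNReal.ofReal (‖likelihoodOp P (b i)‖ ^ 2) = chiSqInfo P + 1 := by
  have hac := absolutelyContinuous_of_chiSqInfo_ne_top hP
  have hL := memLp_rnDeriv hP
  set z : Lp ℝ 2 (P.fst.prod P.snd) := hL.toLp _ with hz
  have hzc : z =ᵐ[P.fst.prod P.snd] fun p => (P.rnDeriv (P.fst.prod P.snd) p).toReal :=
    MemLp.coeFn_toLp _
  -- The coefficients of the kernel in a tensor basis are the matrix entries of the operator;
  -- Parseval for the kernel and for each image `likelihoodOp P (b i)` then gives the identity.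
  have hinner : ∀ g h, inner ℝ (tensorLp g h) z = inner ℝ g (likelihoodOp P h) := by
    intro g h
    rw [inner_likelihoodOp, ← integral_rnDeriv_smul hac, L2.inner_def]
    refine integral_congr_ae ?_
    filter_upwards [hzc, tensorLp_coeFn g h] with p h1 h2
    rw [h1, h2]
    simp
  have hznorm : ENNReal.ofReal (‖z‖ ^ 2) = chiSqInfo P + 1 := by
    rw [chiSqInfo_add_one hP, ← real_inner_self_eq_norm_sq, L2.inner_def]
    congr 1
    refine integral_congr_ae ?_
    filter_upwards [hzc] with p h1
    rw [h1]
    simp [sq]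
  obtain ⟨w, c, -⟩ := exists_hilbertBasis ℝ (Lp ℝ 2 P.fst)
  obtain ⟨e, he⟩ := exists_tensor_hilbertBasis c b
  rw [← hznorm, norm_sq_eq_tsum_of_hasSum (hasSum_inner_smul e z), ENNReal.tsum_prod']
  refine tsum_congr fun i => ?_
  rw [norm_sq_eq_tsum_of_hasSum (hasSum_inner_smul c (likelihoodOp P (b i)))]
  refine tsum_congr fun j => ?_
  rw [he, hinner]

/-- The singular value decomposition of the likelihood operator. -/
theorem exists_svd (hP : chiSqInfo P ≠ ∞) :
    Antitone (lam P) ∧ (∀ k, 0 ≤ lam P k) ∧ lam P 0 = 1 ∧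
    ∑' k, ENNReal.ofReal (lam P k ^ 2) = chiSqInfo P + 1 ∧
    ∃ (φ : {k // lam P k ≠ 0} → X → ℝ) (ψ : {k // lam P k ≠ 0} → Y → ℝ),
      (∀ k, Measurable (φ k)) ∧ (∀ k, Measurable (ψ k)) ∧
      (∀ k, MemLp (φ k) 2 P.fst) ∧ (∀ k, MemLp (ψ k) 2 P.snd) ∧
      (∀ k l, ∫ x, φ k x * φ l x ∂P.fst = if k = l then 1 else 0) ∧
      (∀ k l, ∫ y, ψ k y * ψ l y ∂P.snd = if k = l then 1 else 0) ∧
      (∀ k l, ∫ p, φ k p.1 * ψ l p.2 ∂P = if k = l then lam P k else 0) ∧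
      (∀ k, ∫ x, φ k x ∂P.fst = if k.1 = 0 then 1 else 0) ∧
      (∀ k, ∫ y, ψ k y ∂P.snd = if k.1 = 0 then 1 else 0) := by
  classical
  set T := likelihoodOp P with hT
  have key : Antitone (lam P) ∧ (∀ k, 0 ≤ lam P k) ∧ lam P 0 = 1 ∧
      ∑' k, ENNReal.ofReal (lam P k ^ 2) = chiSqInfo P + 1 ∧
      ∃ ψ : {k // lam P k ≠ 0} → Lp ℝ 2 P.snd, Orthonormal ℝ ψ ∧
        (∀ k, ContinuousLinearMap.adjoint T (T (ψ k)) = lam P k ^ 2 • ψ k) ∧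
        ∀ h : lam P 0 ≠ 0, ψ ⟨0, h⟩ = oneLp P.snd :=
    exists_singular_vectors T (B := chiSqInfo P + 1) (by simpa using hP)
      (fun b => tsum_norm_likelihoodOp_sq hP b) (norm_likelihoodOp_le P) (oneLp P.snd)
      (norm_oneLp _) (by rw [hT, likelihoodOp_one, adjoint_likelihoodOp_one])
  obtain ⟨hanti, hnn, h0, hsum, ψ, hψ, hTψ, hψ0⟩ := key
  refine ⟨hanti, hnn, h0, hsum, ?_⟩
  have hψi := orthonormal_iff_ite.1 hψ
  let φ : {k // lam P k ≠ 0} → Lp ℝ 2 P.fst := fun k => (lam P k)⁻¹ • T (ψ k)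
  have hφT : ∀ k l, inner ℝ (φ k) (T (ψ l)) = if k = l then lam P k else 0 := by
    intro k l
    simp only [φ]
    rw [inner_smul_left, ← ContinuousLinearMap.adjoint_inner_right, hTψ, inner_smul_right, hψi]
    split_ifs with h
    · subst h
      have := k.2
      simp only [conj_trivial]
      field_simp
    · simp
  have hφ : ∀ k l, inner ℝ (φ k) (φ l) = if k = l then 1 else 0 := by
    intro k l
    conv_lhs => rw [show φ l = (lam P l)⁻¹ • T (ψ l) from rfl]
    rw [inner_smul_right, hφT]
    split_ifs with h
    · subst h
      exact inv_mul_cancel₀ k.2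
    · simp
  -- The singular pair at index `0` is the pair of constants `1`, so orthogonality to it is the
  -- mean-zero property of all the others.
  let k₀ : {k // lam P k ≠ 0} := ⟨0, by rw [h0]; exact one_ne_zero⟩
  have hψk₀ : ψ k₀ = oneLp P.snd := hψ0 _
  have hφk₀ : φ k₀ = oneLp P.fst := by
    simp only [φ, hψk₀]
    rw [hT, likelihoodOp_one]
    simp [k₀, h0]
  have hk₀ : ∀ k : {k // lam P k ≠ 0}, k = k₀ ↔ k.1 = 0 := fun k => Subtype.ext_iff
  refine ⟨fun k => φ k, fun k => ψ k, fun k => (Lp.stronglyMeasurable _).measurable,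
    fun k => (Lp.stronglyMeasurable _).measurable, fun k => Lp.memLp _, fun k => Lp.memLp _,
    fun k l => ?_, fun k l => ?_, fun k l => ?_, fun k => ?_, fun k => ?_⟩
  · rw [← hφ k l, L2.inner_def]
    refine integral_congr_ae (ae_of_all _ fun x => ?_)
    simp [mul_comm]
  · rw [← hψi k l, L2.inner_def]
    refine integral_congr_ae (ae_of_all _ fun x => ?_)
    simp [mul_comm]
  · rw [← hφT k l, hT, inner_likelihoodOp]
  · rw [← inner_oneLp, ← hφk₀, hφ]
    simp only [hk₀]
  · rw [← inner_oneLp, ← hψk₀, hψi]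
    simp only [hk₀]

end Likelihood

/-! ### Products over coordinates -/

section PiMeasures

theorem lintegral_pi_prod {Ω : Type*} [MeasurableSpace Ω] {m : ℕ} (μ : Fin m → Measure Ω)
    [∀ i, IsProbabilityMeasure (μ i)] (f : Fin m → Ω → ℝ≥0∞) (hf : ∀ i, Measurable (f i)) :
    ∫⁻ w, ∏ i, f i (w i) ∂Measure.pi μ = ∏ i, ∫⁻ x, f i x ∂μ i := by
  rw [ProbabilityTheory.lintegral_prod_eq_prod_lintegral_of_indepFun Finset.univ
    (fun i (w : Fin m → Ω) => f i (w i))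
    (ProbabilityTheory.iIndepFun_pi fun i => (hf i).aemeasurable)
    fun i => (hf i).comp (measurable_pi_apply i)]
  refine Finset.prod_congr rfl fun i _ => ?_
  exact (measurePreserving_eval μ i).lintegral_comp (hf i)

theorem pi_withDensity {Ω : Type*} [MeasurableSpace Ω] {m : ℕ} (P Q : Measure Ω)
    [IsProbabilityMeasure P] [IsProbabilityMeasure Q] (f : Ω → ℝ≥0∞) (hf : Measurable f)
    (hP : P = Q.withDensity f) :
    Measure.pi (fun _ : Fin m => P) =
      (Measure.pi fun _ : Fin m => Q).withDensity fun w => ∏ i, f (w i) := by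
  refine Measure.pi_eq fun s hs => ?_
  rw [withDensity_apply _ (MeasurableSet.univ_pi hs), ← lintegral_indicator (MeasurableSet.univ_pi hs)]
  have hind : ∀ w : Fin m → Ω, (univ.pi s).indicator (fun w => ∏ i, f (w i)) w =
      ∏ i, (s i).indicator f (w i) := by
    intro w
    by_cases hw : w ∈ univ.pi s
    · rw [indicator_of_mem hw]
      exact Finset.prod_congr rfl fun i _ => (indicator_of_mem (hw i (mem_univ i)) f).symm
    · rw [indicator_of_notMem hw]
      obtain ⟨i, hi⟩ : ∃ i, w i ∉ s i := by
        by_contra! h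
        exact hw fun i _ => h i
      exact (Finset.prod_eq_zero (Finset.mem_univ i) (indicator_of_notMem hi f)).symm
  simp_rw [hind]
  rw [lintegral_pi_prod _ _ fun i => hf.indicator (hs i)]
  refine Finset.prod_congr rfl fun i _ => ?_
  rw [lintegral_indicator (hs i), ← withDensity_apply _ (hs i), ← hP]

theorem memLp_two_pi_prod {Ω : Type*} [MeasurableSpace Ω] {m : ℕ} (μ : Measure Ω)
    [IsProbabilityMeasure μ] (f : Fin m → Ω → ℝ) (hm : ∀ i, Measurable (f i))
    (hf : ∀ i, MemLp (f i) 2 μ) :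
    MemLp (fun w : Fin m → Ω => ∏ i, f i (w i)) 2 (Measure.pi fun _ => μ) := by
  have hmeas : Measurable fun w : Fin m → Ω => ∏ i, f i (w i) :=
    Finset.measurable_fun_prod _ fun i _ => (hm i).comp (measurable_pi_apply i)
  rw [memLp_two_iff_integrable_sq hmeas.aestronglyMeasurable]
  simp_rw [← Finset.prod_pow]
  exact Integrable.fintype_prod (f := fun i x => f i x ^ 2) fun i => (hf i).integrable_sq

theorem ofReal_norm_toLp_sq {Ω : Type*} [MeasurableSpace Ω] {μ : Measure Ω} {f : Ω → ℝ}
    (hf : MemLp f 2 μ) :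
    ENNReal.ofReal (‖hf.toLp f‖ ^ 2) = ∫⁻ x, ENNReal.ofReal (f x ^ 2) ∂μ := by
  rw [← ofReal_integral_eq_lintegral_ofReal hf.integrable_sq (ae_of_all _ fun x => sq_nonneg _),
    ← real_inner_self_eq_norm_sq, L2.inner_def]
  congr 1
  refine integral_congr_ae ?_
  filter_upwards [hf.coeFn_toLp] with x hx
  rw [hx]
  simp [sq]

/-- The whole space is a box of finite measure. -/
def boxSpanningSets {Ω : Type*} [MeasurableSpace Ω] (k : ℕ) (ρ : Measure Ω)
    [IsProbabilityMeasure ρ] : (Measure.pi fun _ : Fin k => ρ).FiniteSpanningSetsIn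
      (univ.pi '' univ.pi fun _ : Fin k => {s : Set Ω | MeasurableSet s}) where
  set _ := univ
  set_mem _ := ⟨fun _ => univ, fun _ _ => MeasurableSet.univ, by simp⟩
  finite _ := measure_lt_top _ _
  spanning := by simp [iUnion_const]

end PiMeasures

/-! ### Densities of the alternative with respect to the null law -/

section Model

variable {X : Type u} {Y : Type v} [MeasurableSpace X] [MeasurableSpace Y]

theorem prod_split_range {M : Type*} [CommMonoid M] {n m : ℕ} (π : Fin m ↪ Fin n) (g : Fin n → M) :
    open Classical in
    ∏ j, g j = (∏ i, g (π i)) * ∏ j, if j ∈ range π then 1 else g j := by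
  classical
  have h1 : ∏ i, g (π i) = ∏ j, if j ∈ range π then g j else 1 := by
    rw [← Finset.prod_filter, ← Finset.prod_map Finset.univ π g]
    refine Finset.prod_congr ?_ fun _ _ => rfl
    ext j
    simp
  rw [h1, ← Finset.prod_mul_distrib]
  refine Finset.prod_congr rfl fun j _ => ?_
  split_ifs <;> simp

/-- Under independent pairs the assembled data have the null law. -/
theorem map_assemble_prod (μ : Measure X) (ν : Measure Y) [IsProbabilityMeasure μ]
    [IsProbabilityMeasure ν] {n m : ℕ} (π : Fin m ↪ Fin n) :
    ((Measure.pi fun _ : Fin m => μ.prod ν).prod (Measure.pi fun _ : Fin n => μ)).map (assemble π) =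
      (Measure.pi fun _ : Fin n => μ).prod (Measure.pi fun _ : Fin m => ν) := by
  classical
  symm
  refine Measure.prod_eq_generateFrom generateFrom_pi generateFrom_pi isPiSystem_pi isPiSystem_pi
    (boxSpanningSets n μ) (boxSpanningSets m ν) ?_
  rintro _ ⟨s, hs, rfl⟩ _ ⟨t, ht, rfl⟩
  have hs' : ∀ j, MeasurableSet (s j) := fun j => hs j (mem_univ j)
  have ht' : ∀ i, MeasurableSet (t i) := fun i => ht i (mem_univ i)
  rw [Measure.map_apply (measurable_assemble π)
    ((MeasurableSet.univ_pi hs').prod (MeasurableSet.univ_pi ht'))]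
  -- It suffices to compare boxes. The preimage of a box is a box: places in the range of `π`
  -- constrain the pairs, the others the independent sample.
  have hpre : assemble π ⁻¹' (univ.pi s ×ˢ univ.pi t) =
      (univ.pi fun i => s (π i) ×ˢ t i) ×ˢ
        (univ.pi fun j => if j ∈ range π then univ else s j) := by
    ext w
    simp only [mem_preimage, mem_prod, mem_univ_pi, assemble]
    constructor
    · rintro ⟨h1, h2⟩
      refine ⟨fun i => ⟨?_, h2 i⟩, fun j => ?_⟩
      · have := h1 (π i)
        rwa [π.injective.extend_apply] at this
      · split_ifs with hj
        · trivial
        · have := h1 j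
          rwa [Function.extend_apply' _ _ _ hj] at this
    · rintro ⟨h1, h2⟩
      refine ⟨fun j => ?_, fun i => (h1 i).2⟩
      by_cases hj : j ∈ range π
      · obtain ⟨i, rfl⟩ := hj
        rw [π.injective.extend_apply]
        exact (h1 i).1
      · rw [Function.extend_apply' _ _ _ hj]
        have := h2 j
        rwa [if_neg hj] at this
  rw [hpre, Measure.prod_prod, Measure.pi_pi, Measure.pi_pi, Measure.pi_pi, Measure.pi_pi,
    prod_split_range π fun j => μ (s j)]
  simp_rw [Measure.prod_prod]
  rw [Finset.prod_mul_distrib, mul_right_comm]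
  congr 2
  refine Finset.prod_congr rfl fun j _ => ?_
  split_ifs <;> simp

variable (P : Measure (X × Y))

/-- The likelihood ratio given the injection `π`. -/
noncomputable def densityGiven {n m : ℕ} (π : Fin m ↪ Fin n)
    (w : (Fin n → X) × (Fin m → Y)) : ℝ≥0∞ :=
  ∏ i, P.rnDeriv (P.fst.prod P.snd) (w.1 (π i), w.2 i)

theorem measurable_densityGiven {n m : ℕ} (π : Fin m ↪ Fin n) :
    Measurable (densityGiven P π) := by
  refine Finset.measurable_fun_prod _ fun i _ => (Measure.measurable_rnDeriv _ _).comp ?_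
  fun_prop

theorem densityGiven_assemble {n m : ℕ} (π : Fin m ↪ Fin n)
    (w : (Fin m → X × Y) × (Fin n → X)) :
    densityGiven P π (assemble π w) = ∏ i, P.rnDeriv (P.fst.prod P.snd) (w.1 i) := by
  refine Finset.prod_congr rfl fun i _ => ?_
  simp [assemble, π.injective.extend_apply]

variable [IsProbabilityMeasure P]

instance isProbabilityMeasure_nullLaw (n m : ℕ) : IsProbabilityMeasure (nullLaw P n m) := by
  unfold nullLaw
  infer_instance

instance isProbabilityMeasure_altLawGiven {n m : ℕ} (π : Fin m ↪ Fin n) :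
    IsProbabilityMeasure (altLawGiven P π) := by
  unfold altLawGiven
  exact Measure.isProbabilityMeasure_map (measurable_assemble π).aemeasurable

theorem isProbabilityMeasure_altLaw {n m : ℕ} (hmn : m ≤ n) :
    IsProbabilityMeasure (altLaw P n m) := by
  constructor
  rw [altLaw, Measure.smul_apply, Measure.finsetSum_apply]
  simp only [measure_univ, Finset.sum_const, Finset.card_univ, smul_eq_mul, nsmul_eq_mul, mul_one]
  exact ENNReal.inv_mul_cancel (card_embedding_ne_zero hmn) (by simp)

variable {P}

/-- Both laws are images under `assemble π`, of `P`-pairs and of independent pairs. The density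
between the sources depends only on the assembled data, so it descends to the images. -/
theorem altLawGiven_eq_withDensity (hP : P ≪ P.fst.prod P.snd) {n m : ℕ} (π : Fin m ↪ Fin n) :
    altLawGiven P π = (nullLaw P n m).withDensity (densityGiven P π) := by
  have hm := measurable_densityGiven P π
  ext s hs
  rw [withDensity_apply _ hs, nullLaw, ← map_assemble_prod P.fst P.snd π,
    setLIntegral_map hs hm (measurable_assemble π), altLawGiven,
    Measure.map_apply (measurable_assemble π) hs,
    pi_withDensity P (P.fst.prod P.snd) _ (Measure.measurable_rnDeriv _ _)
      (Measure.withDensity_rnDeriv_eq _ _ hP).symm, prod_withDensity_left,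
    withDensity_apply _ (measurable_assemble π hs)]
  · simp_rw [densityGiven_assemble]
  · exact Finset.measurable_fun_prod _ fun i _ =>
      (Measure.measurable_rnDeriv _ _).comp (measurable_pi_apply i)

theorem lintegral_densityGiven_sq (hP : chiSqInfo P ≠ ∞) {n m : ℕ} (π : Fin m ↪ Fin n) :
    ∫⁻ w, densityGiven P π w ^ 2 ∂nullLaw P n m = (chiSqInfo P + 1) ^ m := by
  have hone : ∫⁻ p, P.rnDeriv (P.fst.prod P.snd) p ^ 2 ∂P.fst.prod P.snd = chiSqInfo P + 1 := by
    rw [chiSqInfo_add_one hP, ofReal_integral_eq_lintegral_ofReal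
      (memLp_rnDeriv hP).integrable_sq (ae_of_all _ fun p => sq_nonneg _)]
    refine lintegral_congr_ae ?_
    filter_upwards [Measure.rnDeriv_lt_top P (P.fst.prod P.snd)] with p hp
    rw [ENNReal.ofReal_pow ENNReal.toReal_nonneg, ENNReal.ofReal_toReal hp.ne]
  rw [nullLaw, ← map_assemble_prod P.fst P.snd π,
    lintegral_map ((measurable_densityGiven P π).pow_const 2) (measurable_assemble π)]
  simp_rw [densityGiven_assemble, ← Finset.prod_pow]
  have hmeas : Measurable fun p => P.rnDeriv (P.fst.prod P.snd) p ^ 2 :=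
    (Measure.measurable_rnDeriv _ _).pow_const 2
  have hmeas' : Measurable fun w : Fin m → X × Y =>
      ∏ i, P.rnDeriv (P.fst.prod P.snd) (w i) ^ 2 :=
    Finset.measurable_fun_prod _ fun i _ => hmeas.comp (measurable_pi_apply i)
  rw [measurePreserving_fst.lintegral_comp hmeas']
  rw [lintegral_pi_prod _ _ fun i => hmeas]
  simp [hone]

theorem altLaw_eq_withDensity (hP : P ≪ P.fst.prod P.snd) (n m : ℕ) :
    altLaw P n m = (nullLaw P n m).withDensity fun w =>
      (Fintype.card (Fin m ↪ Fin n) : ℝ≥0∞)⁻¹ * ∑ π : Fin m ↪ Fin n, densityGiven P π w := by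
  have hm : Measurable fun w => ∑ π : Fin m ↪ Fin n, densityGiven P π w :=
    Finset.measurable_fun_sum _ fun π _ => measurable_densityGiven P π
  ext s hs
  rw [withDensity_apply _ hs, lintegral_const_mul _ hm,
    lintegral_finsetSum _ fun π _ => measurable_densityGiven P π, altLaw, Measure.smul_apply,
    Measure.finsetSum_apply, smul_eq_mul]
  congr 1
  refine Finset.sum_congr rfl fun π _ => ?_
  rw [altLawGiven_eq_withDensity hP, withDensity_apply _ hs]

end Model

/-! ### Orthogonal expansion of the likelihood ratio and the exact second moment -/

section SecondMoment

variable {X : Type u} {Y : Type v} [MeasurableSpace X] [MeasurableSpace Y]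

/-- A product of single-coordinate functions of the data. -/
def productFn {ι : Type*} {n m : ℕ} (φ : ι → X → ℝ) (ψ : ι → Y → ℝ)
    (q : (Fin n → ι) × (Fin m → ι)) (w : (Fin n → X) × (Fin m → Y)) : ℝ :=
  (∏ j, φ (q.1 j) (w.1 j)) * ∏ i, ψ (q.2 i) (w.2 i)

variable {ι : Type*} {P : Measure (X × Y)} [IsProbabilityMeasure P] {φ : ι → X → ℝ}
  {ψ : ι → Y → ℝ}

theorem memLp_productFn (hφm : ∀ k, Measurable (φ k)) (hψm : ∀ k, Measurable (ψ k))
    (hφ : ∀ k, MemLp (φ k) 2 P.fst) (hψ : ∀ k, MemLp (ψ k) 2 P.snd) {n m : ℕ}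
    (q : (Fin n → ι) × (Fin m → ι)) : MemLp (productFn φ ψ q) 2 (nullLaw P n m) :=
  memLp_two_mul_prod (memLp_two_pi_prod P.fst _ (fun j => hφm (q.1 j)) fun j => hφ (q.1 j))
    (memLp_two_pi_prod P.snd _ (fun i => hψm (q.2 i)) fun i => hψ (q.2 i))

theorem prod_ite_eq_ite_funext {κ : Type*} [DecidableEq ι] [Fintype κ] (f g : κ → ι) (c : κ → ℝ) :
    open Classical in
    ∏ j, (if f j = g j then c j else 0) = if f = g then ∏ j, c j else 0 := by
  classical
  split_ifs with h
  · exact Finset.prod_congr rfl fun j _ => by rw [if_pos (congrFun h j)]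
  · obtain ⟨j, hj⟩ := Function.ne_iff.1 h
    exact Finset.prod_eq_zero (Finset.mem_univ j) (if_neg hj)

theorem integral_productFn_mul [DecidableEq ι]
    (hφφ : ∀ k l, ∫ x, φ k x * φ l x ∂P.fst = if k = l then 1 else 0)
    (hψψ : ∀ k l, ∫ y, ψ k y * ψ l y ∂P.snd = if k = l then 1 else 0) {n m : ℕ}
    (q q' : (Fin n → ι) × (Fin m → ι)) :
    open Classical in
    ∫ w, productFn φ ψ q w * productFn φ ψ q' w ∂nullLaw P n m = if q = q' then 1 else 0 := by
  classical
  have hre : ∀ w : (Fin n → X) × (Fin m → Y), productFn φ ψ q w * productFn φ ψ q' w =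
      (∏ j, φ (q.1 j) (w.1 j) * φ (q'.1 j) (w.1 j)) *
        ∏ i, ψ (q.2 i) (w.2 i) * ψ (q'.2 i) (w.2 i) := by
    intro w
    simp only [productFn, Finset.prod_mul_distrib]
    ring
  simp_rw [hre]
  rw [nullLaw, integral_prod_mul
    (fun x : Fin n → X => ∏ j, φ (q.1 j) (x j) * φ (q'.1 j) (x j))
    (fun y : Fin m → Y => ∏ i, ψ (q.2 i) (y i) * ψ (q'.2 i) (y i)),
    integral_fintype_prod_eq_prod (fun j x => φ (q.1 j) x * φ (q'.1 j) x),
    integral_fintype_prod_eq_prod (fun i y => ψ (q.2 i) y * ψ (q'.2 i) y)]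
  simp_rw [hφφ, hψψ]
  rw [prod_ite_eq_ite_funext, prod_ite_eq_ite_funext]
  by_cases h1 : q.1 = q'.1 <;> by_cases h2 : q.2 = q'.2 <;> simp [h1, h2, Prod.ext_iff]

/-- By independence, a matched pair contributes `c` if its two letters agree and `0` otherwise, and
an unmatched coordinate contributes `1` if its letter is `o` and `0` otherwise. -/
theorem integral_productFn_altLawGiven [DecidableEq ι] (o : ι) {c : ι → ℝ}
    (hφm : ∀ k, Measurable (φ k)) (hψm : ∀ k, Measurable (ψ k))
    (hφψ : ∀ k l, ∫ p, φ k p.1 * ψ l p.2 ∂P = if k = l then c k else 0)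
    (hφo : ∀ k, ∫ x, φ k x ∂P.fst = if k = o then 1 else 0) {n m : ℕ} (π : Fin m ↪ Fin n)
    (q : (Fin n → ι) × (Fin m → ι)) :
    open Classical in
    ∫ w, productFn φ ψ q w ∂altLawGiven P π =
      if spread o π q.2 = q.1 then ∏ i, c (q.2 i) else 0 := by
  classical
  have hmeas : Measurable (productFn φ ψ q) := by
    refine Measurable.mul ?_ ?_
    · exact Finset.measurable_fun_prod _ fun j _ => (hφm _).comp (by fun_prop)
    · exact Finset.measurable_fun_prod _ fun j _ => (hψm _).comp (by fun_prop)
  rw [altLawGiven, integral_map (measurable_assemble π).aemeasurable hmeas.aestronglyMeasurable]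
  have hre : ∀ w : (Fin m → X × Y) × (Fin n → X), productFn φ ψ q (assemble π w) =
      (∏ i, φ (q.1 (π i)) (w.1 i).1 * ψ (q.2 i) (w.1 i).2) *
        ∏ j, if j ∈ range π then 1 else φ (q.1 j) (w.2 j) := by
    intro w
    have hj : ∀ j, (if j ∈ range π then 1 else φ (q.1 j) ((assemble π w).1 j)) =
        if j ∈ range π then 1 else φ (q.1 j) (w.2 j) := by
      intro j
      split_ifs with h
      · rfl
      · simp only [assemble]
        rw [Function.extend_apply' _ _ _ h]
    have hi : ∀ i, (assemble π w).1 (π i) = (w.1 i).1 := fun i => by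
      simp only [assemble]
      rw [π.injective.extend_apply]
    rw [productFn, prod_split_range π fun j => φ (q.1 j) ((assemble π w).1 j)]
    simp_rw [hj, hi, Finset.prod_mul_distrib, assemble]
    ring
  simp_rw [hre]
  rw [integral_prod_mul
    (fun a : Fin m → X × Y => ∏ i, φ (q.1 (π i)) (a i).1 * ψ (q.2 i) (a i).2)
    (fun b : Fin n → X => ∏ j, if j ∈ range π then 1 else φ (q.1 j) (b j)),
    integral_fintype_prod_eq_prod (fun i (p : X × Y) => φ (q.1 (π i)) p.1 * ψ (q.2 i) p.2),
    integral_fintype_prod_eq_prod (fun j x => if j ∈ range π then 1 else φ (q.1 j) x)]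
  simp_rw [hφψ]
  have hright : ∀ j, ∫ x, (if j ∈ range π then 1 else φ (q.1 j) x) ∂P.fst =
      if j ∈ range π then 1 else if q.1 j = o then 1 else 0 := by
    intro j
    split_ifs with h h' <;> simp [*]
  simp_rw [hright]
  split_ifs with h
  · rw [← h]
    simp_rw [spread_apply]
    simp only [if_true]
    have hone : ∏ j, (if j ∈ range π then 1 else if spread o π q.2 j = o then (1 : ℝ) else 0) = 1 := by
      refine Finset.prod_eq_one fun j _ => ?_
      split_ifs with h1 h2
      · rfl
      · rfl
      · exact absurd (spread_of_notMem o π q.2 h1) h2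
    rw [hone, mul_one]
  · obtain ⟨j, hj⟩ := Function.ne_iff.1 h
    by_cases hjr : j ∈ range π
    · obtain ⟨i, rfl⟩ := hjr
      rw [spread_apply] at hj
      rw [Finset.prod_eq_zero (Finset.mem_univ i) (if_neg (Ne.symm hj)), zero_mul]
    · rw [spread_of_notMem o π q.2 hjr] at hj
      rw [mul_comm, Finset.prod_eq_zero (Finset.mem_univ j), zero_mul]
      rw [if_neg hjr, if_neg (Ne.symm hj)]

/-- Parseval for the averaged likelihood ratio, whose squared coefficients are those summed by
`tsum_prod_mul_spreadProb_sq`. The blank letter is index `0`, so the variables are `λ_1², λ_2², …`.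
-/
theorem secondMoment_eq (hP : chiSqInfo P ≠ ∞) {n m : ℕ} (hmn : m ≤ n) :
    secondMoment P n m = ∑' α : ℕ →₀ ℕ,
      monomialEval (fun k => ENNReal.ofReal (lam P (k + 1) ^ 2)) α *
        ENNReal.ofReal (coverProb n m α.degree) := by
  classical
  obtain ⟨-, hnn, h0, hsum, φ, ψ, hφm, hψm, hφ, hψ, hφφ, hψψ, hφψ, hφo, -⟩ := exists_svd hP
  let o : {k // lam P k ≠ 0} := ⟨0, by rw [h0]; exact one_ne_zero⟩
  have hφo' : ∀ k, ∫ x, φ k x ∂P.fst = if k = o then 1 else 0 := fun k => by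
    rw [hφo]
    simp only [o, Subtype.ext_iff]
  let a : {k // lam P k ≠ 0} → ℝ≥0∞ := fun k => ENNReal.ofReal (lam P k ^ 2)
  have hao : a o = 1 := by simp [a, o, h0]
  have hasum : ∑' k, a k = chiSqInfo P + 1 := by
    rw [← hsum]
    refine tsum_subtype_eq_of_support_subset (s := {k | lam P k ≠ 0})
      (f := fun k => ENNReal.ofReal (lam P k ^ 2)) fun k hk h => hk (by simp [h])
  have hac := absolutelyContinuous_of_chiSqInfo_ne_top hP
  set N : ℝ≥0∞ := (Fintype.card (Fin m ↪ Fin n) : ℝ≥0∞) with hN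
  -- the orthonormal system
  let E : (Fin n → {k // lam P k ≠ 0}) × (Fin m → {k // lam P k ≠ 0}) → Lp ℝ 2 (nullLaw P n m) :=
    fun q => (memLp_productFn hφm hψm hφ hψ q).toLp _
  have hEc : ∀ q, E q =ᵐ[nullLaw P n m] productFn φ ψ q := fun q => MemLp.coeFn_toLp _
  have hE : Orthonormal ℝ E := by
    rw [orthonormal_iff_ite]
    intro q q'
    have := integral_productFn_mul (P := P) hφφ hψψ q q'
    rw [L2.inner_def]
    refine Eq.trans (integral_congr_ae ?_) (this.trans (by congr))
    filter_upwards [hEc q, hEc q'] with w h1 h2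
    rw [h1, h2, RCLike.inner_apply, conj_trivial, mul_comm]
  -- the conditional likelihood ratios
  have hfin : ∀ π : Fin m ↪ Fin n, ∀ᵐ w ∂nullLaw P n m, densityGiven P π w < ∞ := by
    intro π
    have hlt : ∫⁻ w, densityGiven P π w ^ 2 ∂nullLaw P n m ≠ ∞ := by
      rw [lintegral_densityGiven_sq hP]
      exact ENNReal.pow_ne_top (by simpa using hP)
    filter_upwards [ae_lt_top ((measurable_densityGiven P π).pow_const 2) hlt] with w hw
    by_contra h
    rw [not_lt, top_le_iff] at h
    simp [h] at hw
  have hsq : ∀ π : Fin m ↪ Fin n,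
      ∫⁻ w, ENNReal.ofReal ((densityGiven P π w).toReal ^ 2) ∂nullLaw P n m =
        (chiSqInfo P + 1) ^ m := by
    intro π
    rw [← lintegral_densityGiven_sq hP π]
    refine lintegral_congr_ae ?_
    filter_upwards [hfin π] with w hw
    rw [ENNReal.ofReal_pow ENNReal.toReal_nonneg, ENNReal.ofReal_toReal hw.ne]
  have hmem : ∀ π : Fin m ↪ Fin n,
      MemLp (fun w => (densityGiven P π w).toReal) 2 (nullLaw P n m) := by
    intro π
    have hm := (measurable_densityGiven P π).ennreal_toReal
    rw [memLp_two_iff_integrable_sq hm.aestronglyMeasurable]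
    refine ⟨(hm.pow_const 2).aestronglyMeasurable, ?_⟩
    rw [hasFiniteIntegral_iff_ofReal (ae_of_all _ fun w => sq_nonneg _), hsq π]
    exact (ENNReal.pow_ne_top (by simpa using hP)).lt_top
  let F : (Fin m ↪ Fin n) → Lp ℝ 2 (nullLaw P n m) := fun π => (hmem π).toLp _
  have hFc : ∀ π, F π =ᵐ[nullLaw P n m] fun w => (densityGiven P π w).toReal :=
    fun π => MemLp.coeFn_toLp _
  have hEF : ∀ q π, inner ℝ (E q) (F π) =
      if spread o π q.2 = q.1 then ∏ i, lam P (q.2 i) else 0 := by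
    intro q π
    rw [← integral_productFn_altLawGiven (P := P) o hφm hψm hφψ hφo' π q,
      altLawGiven_eq_withDensity hac, integral_withDensity_eq_integral_toReal_smul
        (measurable_densityGiven P π) (hfin π), L2.inner_def]
    refine integral_congr_ae ?_
    filter_upwards [hEc q, hFc π] with w h1 h2
    rw [h1, h2, RCLike.inner_apply, conj_trivial, smul_eq_mul]
  have hprodsq : ∀ k : Fin m → {k // lam P k ≠ 0},
      ENNReal.ofReal ((∏ i, lam P (k i)) ^ 2) = ∏ i, a (k i) := by
    intro k
    rw [← Finset.prod_pow, ENNReal.ofReal_prod_of_nonneg fun i _ => sq_nonneg _]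
  -- The system `E` need not be complete. Bessel's inequality is nevertheless an equality for `F π`:
  -- its squared norm is `(χ² + 1)^m = (∑ λ_k²)^m`, which is also the sum of its squared
  -- coefficients.
  have hFsum : ∀ π, HasSum (fun q => inner ℝ (E q) (F π) • E q) (F π) := by
    intro π
    refine hasSum_of_norm_sq_le hE (le_of_eq ?_)
    rw [ofReal_norm_toLp_sq, hsq, ← hasum]
    have h1 : (∑' k, a k) ^ m = ∑' k : Fin m → {k // lam P k ≠ 0}, ∏ i, a (k i) := by
      rw [tsum_pi_prod fun _ => a]
      simp
    rw [h1, ENNReal.tsum_prod', ENNReal.tsum_comm]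
    refine tsum_congr fun k => ?_
    rw [tsum_eq_single (spread o π k)]
    · rw [hEF, if_pos rfl, hprodsq]
    · intro κ hκ
      rw [hEF, if_neg (Ne.symm hκ)]
      simp
  -- the averaged likelihood ratio
  let z : Lp ℝ 2 (nullLaw P n m) := ∑ π, N⁻¹.toReal • F π
  have hzsum : HasSum (fun q => inner ℝ (E q) z • E q) z := by
    have := hasSum_sum (s := Finset.univ) fun π _ => (hFsum π).const_smul N⁻¹.toReal
    refine this.congr_fun fun q => ?_
    simp only [z, inner_sum, inner_smul_right, Finset.sum_smul, mul_smul]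
  have hEz : ∀ q, ENNReal.ofReal (inner ℝ (E q) z ^ 2) =
      (∏ i, a (q.2 i)) * spreadProb o q.2 q.1 ^ 2 := by
    intro q
    have hin : inner ℝ (E q) z = (∏ i, lam P (q.2 i)) * (spreadProb o q.2 q.1).toReal := by
      simp only [z, inner_sum, inner_smul_right, hEF]
      rw [spreadProb_eq_sum, ← Finset.sum_mul, ENNReal.toReal_mul,
        ENNReal.toReal_sum (by intro π _; split_ifs <;> simp), ← Finset.mul_sum, mul_comm,
        ← mul_assoc, Finset.mul_sum]
      congr 1
      refine Finset.sum_congr rfl fun π _ => ?_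
      split_ifs <;> simp
    have hne : spreadProb o q.2 q.1 ≠ ∞ :=
      ENNReal.div_ne_top (by simp) (card_embedding_ne_zero hmn)
    rw [hin, mul_pow, ENNReal.ofReal_mul (sq_nonneg _), hprodsq,
      ENNReal.ofReal_pow ENNReal.toReal_nonneg, ENNReal.ofReal_toReal hne]
  have hNtop : N⁻¹ ≠ ∞ := ENNReal.inv_ne_top.2 (card_embedding_ne_zero hmn)
  have hz : secondMoment P n m = ENNReal.ofReal (‖z‖ ^ 2) := by
    have hzL : ENNReal.ofReal (‖z‖ ^ 2) = ∫⁻ w, ENNReal.ofReal (z w ^ 2) ∂nullLaw P n m := by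
      have := ofReal_norm_toLp_sq (Lp.memLp z)
      rwa [Lp.toLp_coeFn] at this
    have hmeas : Measurable fun w => N⁻¹ * ∑ π : Fin m ↪ Fin n, densityGiven P π w :=
      (Finset.measurable_fun_sum _ fun π _ => measurable_densityGiven P π).const_mul _
    have hrn := Measure.rnDeriv_withDensity (nullLaw P n m) hmeas
    rw [← altLaw_eq_withDensity hac] at hrn
    have hzc : z =ᵐ[nullLaw P n m] fun w =>
        ∑ π : Fin m ↪ Fin n, N⁻¹.toReal * (densityGiven P π w).toReal := by
      have h1 : z =ᵐ[nullLaw P n m] ∑ π : Fin m ↪ Fin n, ⇑(N⁻¹.toReal • F π) :=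
        Lp.coeFn_finsetSum _ _
      have h2 : ∀ᵐ w ∂nullLaw P n m, ∀ π : Fin m ↪ Fin n,
          (N⁻¹.toReal • F π) w = N⁻¹.toReal * (densityGiven P π w).toReal := by
        rw [ae_all_iff]
        intro π
        filter_upwards [Lp.coeFn_smul N⁻¹.toReal (F π), hFc π] with w h3 h4
        rw [h3, Pi.smul_apply, h4, smul_eq_mul]
      filter_upwards [h1, h2] with w h3 h4
      rw [h3, Finset.sum_apply]
      exact Finset.sum_congr rfl fun π _ => h4 π
    rw [hzL, secondMoment]
    refine lintegral_congr_ae ?_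
    filter_upwards [hrn, hzc, ae_all_iff.2 hfin] with w h1 h2 h3
    rw [h1, h2, ← Finset.mul_sum, ← ENNReal.toReal_sum fun π _ => (h3 π).ne, ← ENNReal.toReal_mul,
      ENNReal.ofReal_pow ENNReal.toReal_nonneg, ENNReal.ofReal_toReal]
    exact ENNReal.mul_ne_top hNtop (ENNReal.sum_ne_top.2 fun π _ => (h3 π).ne)
  rw [hz, norm_sq_eq_tsum_of_hasSum hzsum]
  simp_rw [hEz]
  rw [ENNReal.tsum_prod', tsum_prod_mul_spreadProb_sq o hmn a hao]
  have hpos : ∀ x : {x : {k // lam P k ≠ 0} // x ≠ o}, 0 < x.1.1 := fun x =>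
    Nat.pos_of_ne_zero fun h => x.2 (Subtype.ext h)
  -- The nonblank letters are the `k ≥ 1` with nonzero singular value, shifted down by one; the
  -- missing indices carry the value `0`.
  let f : {x : {k // lam P k ≠ 0} // x ≠ o} ↪ ℕ :=
    ⟨fun x => x.1.1 - 1, fun x y h => by
      have h1 := hpos x
      have h2 := hpos y
      simp only at h
      exact Subtype.ext (Subtype.ext (by omega))⟩
  have hf : ∀ x, f x + 1 = x.1.1 := fun x => Nat.sub_add_cancel (hpos x)
  rw [← tsum_monomialEval_embedding f _ ?_ fun r => ENNReal.ofReal (coverProb n m r)]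
  · simp_rw [hf]
    rfl
  · intro k hk
    by_contra h
    have hlam : lam P (k + 1) ≠ 0 := fun h' => h (by simp [h'])
    refine hk ⟨⟨⟨k + 1, hlam⟩, fun h' => ?_⟩, rfl⟩
    have := congrArg Subtype.val h'
    simp [o] at this

/-- The case `m = 0` needs its own argument in claim (3): there `n / m = ∞` for `n ≥ 1`, and the
hypothesis says nothing about the `χ²`-information. -/
theorem altLaw_zero (n : ℕ) : altLaw P n 0 = nullLaw P n 0 := by
  have h : ∀ π : Fin 0 ↪ Fin n, altLawGiven P π = nullLaw P n 0 := by
    intro π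
    have h1 : Measure.pi (fun _ : Fin 0 => P) = Measure.pi fun _ : Fin 0 => P.fst.prod P.snd := by
      refine Measure.pi_eq fun s _ => ?_
      rw [Measure.pi_pi]
      simp
    rw [altLawGiven, h1, map_assemble_prod, nullLaw]
  simp_rw [altLaw, h]
  simp

theorem secondMoment_zero (n : ℕ) : secondMoment P n 0 = 1 := by
  rw [secondMoment, altLaw_zero]
  have : ∀ᵐ w ∂nullLaw P n 0, (nullLaw P n 0).rnDeriv (nullLaw P n 0) w ^ 2 = 1 := by
    filter_upwards [Measure.rnDeriv_self (nullLaw P n 0)] with w hw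
    rw [hw, one_pow]
  rw [lintegral_congr_ae this]
  simp

end SecondMoment

/-! ### Estimates of the second moment; singular values and maximal correlation -/

section Bounds

variable {X : Type u} {Y : Type v} [MeasurableSpace X] [MeasurableSpace Y]
  {P : Measure (X × Y)} [IsProbabilityMeasure P]

theorem tsum_lam_succ_sq (hP : chiSqInfo P ≠ ∞) :
    ∑' k, ENNReal.ofReal (lam P (k + 1) ^ 2) = chiSqInfo P := by
  obtain ⟨-, -, h0, hsum, -⟩ := exists_svd hP
  rw [tsum_eq_zero_add' ENNReal.summable, h0, one_pow, ENNReal.ofReal_one, add_comm] at hsum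
  exact (ENNReal.add_left_inj ENNReal.one_ne_top).1 hsum

theorem summable_lam_succ_sq (hP : chiSqInfo P ≠ ∞) : Summable fun k => lam P (k + 1) ^ 2 := by
  have h := ENNReal.summable_toReal (f := fun k => ENNReal.ofReal (lam P (k + 1) ^ 2))
    (by rw [tsum_lam_succ_sq hP]; exact hP)
  simpa [ENNReal.toReal_ofReal (sq_nonneg _)] using h

theorem ofReal_tsum_lam_succ_sq (hP : chiSqInfo P ≠ ∞) :
    ENNReal.ofReal (∑' k, lam P (k + 1) ^ 2) = chiSqInfo P := by
  rw [ENNReal.ofReal_tsum_of_nonneg (fun k => sq_nonneg _) (summable_lam_succ_sq hP),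
    tsum_lam_succ_sq hP]

theorem lam_succ_sq_le_one (hP : chiSqInfo P ≠ ∞) (k : ℕ) : lam P (k + 1) ^ 2 ≤ 1 := by
  obtain ⟨hanti, hnn, h0, -⟩ := exists_svd hP
  exact pow_le_one₀ (hnn _) (h0 ▸ hanti (Nat.zero_le _))

theorem lam_succ_sq_le (hP : chiSqInfo P ≠ ∞) {b : ℝ} (hb : lam P 1 ≤ b) (k : ℕ) :
    lam P (k + 1) ^ 2 ≤ b ^ 2 := by
  obtain ⟨hanti, hnn, -⟩ := exists_svd hP
  exact pow_le_pow_left₀ (hnn _) ((hanti (Nat.le_add_left 1 k)).trans hb) 2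

/-- The bound `(m/n)^|α|` on the cover probability is absorbed into the variables by homogeneity,
and the series becomes a product of geometric series. -/
theorem secondMoment_le_tprod (hP : chiSqInfo P ≠ ∞) {n m : ℕ} (hmn : m ≤ n)
    (hlt : ∀ k, (m : ℝ) / n * lam P (k + 1) ^ 2 < 1) :
    secondMoment P n m ≤
      ENNReal.ofReal (∏' k : ℕ, 1 / (1 - (m : ℝ) / n * lam P (k + 1) ^ 2)) := by
  have hnn : ∀ k, 0 ≤ (m : ℝ) / n * lam P (k + 1) ^ 2 := fun k => by positivity
  rw [← tsum_monomialEval_ofReal hnn hlt (multipliable_one_div_one_sub hnn hlt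
    ((summable_lam_succ_sq hP).mul_left _)), secondMoment_eq hP hmn]
  refine ENNReal.tsum_le_tsum fun α => ?_
  have hre : (fun k => ENNReal.ofReal ((m : ℝ) / n * lam P (k + 1) ^ 2)) =
      fun k => ENNReal.ofReal ((m : ℝ) / n) * ENNReal.ofReal (lam P (k + 1) ^ 2) :=
    funext fun k => ENNReal.ofReal_mul (by positivity)
  rw [hre, monomialEval_mul_const, mul_comm]
  refine mul_le_mul_left ?_ _
  rw [← ENNReal.ofReal_pow (by positivity)]
  exact ENNReal.ofReal_le_ofReal (coverProb_le_pow hmn _)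

theorem secondMoment_le_exp (hP : chiSqInfo P ≠ ∞) {n m : ℕ} (hmn : m ≤ n) {c B : ℝ} (hc : 0 < c)
    (hle : ∀ k, (m : ℝ) / n * lam P (k + 1) ^ 2 ≤ 1 - c)
    (hB : ENNReal.ofReal ((m : ℝ) / n) * chiSqInfo P ≤ ENNReal.ofReal B) (hB0 : 0 ≤ B) :
    secondMoment P n m ≤ ENNReal.ofReal (Real.exp (B / c)) := by
  refine (secondMoment_le_tprod hP hmn fun k => by linarith [hle k]).trans
    (ENNReal.ofReal_le_ofReal ?_)
  refine tprod_one_div_one_sub_le hc (fun k => by positivity) hle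
    ((summable_lam_succ_sq hP).mul_left _) ?_
  rw [tsum_mul_left]
  rw [← ofReal_tsum_lam_succ_sq hP, ← ENNReal.ofReal_mul (by positivity)] at hB
  exact (ENNReal.ofReal_le_ofReal_iff hB0).1 hB

/-- The product is the same series without cover probabilities, so the error is the sum of `λ^{2α}
(1 - coverProb)`. In degree at most `R` the last factor is at most `1 - coverProb n m R`; in higher
degree it is at most `1 ≤ θ^{-R} θ^|α|`. Both are dominated using the series in `θ λ_k²`, which
`exp(B/c)` bounds. -/
theorem tprod_le_secondMoment_add (hP : chiSqInfo P ≠ ∞) {n m : ℕ} (hmn : m ≤ n) {θ c B : ℝ}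
    (hθ : 1 ≤ θ) (hc : 0 < c) (hle : ∀ k, θ * lam P (k + 1) ^ 2 ≤ 1 - c)
    (hB : ∑' k, θ * lam P (k + 1) ^ 2 ≤ B) (R : ℕ) :
    secondMoment P n m ≤ ENNReal.ofReal (∏' k : ℕ, 1 / (1 - lam P (k + 1) ^ 2)) ∧
    ENNReal.ofReal (∏' k : ℕ, 1 / (1 - lam P (k + 1) ^ 2)) ≤ secondMoment P n m +
      ENNReal.ofReal ((1 - coverProb n m R + (θ ^ R)⁻¹) * Real.exp (B / c)) := by
  have hθ0 : 0 < θ := by linarith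
  have hnn : ∀ k, 0 ≤ lam P (k + 1) ^ 2 := fun k => sq_nonneg _
  have hnn' : ∀ k, 0 ≤ θ * lam P (k + 1) ^ 2 := fun k => by positivity
  have hlt' : ∀ k, θ * lam P (k + 1) ^ 2 < 1 := fun k => by linarith [hle k]
  have hlt : ∀ k, lam P (k + 1) ^ 2 < 1 := fun k =>
    (le_mul_of_one_le_left (hnn k) hθ).trans_lt (hlt' k)
  have hs := summable_lam_succ_sq hP
  have hδ : 0 ≤ 1 - coverProb n m R + (θ ^ R)⁻¹ := by
    have := coverProb_le_one hmn R
    have : 0 < (θ ^ R)⁻¹ := by positivity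
    linarith
  rw [← tsum_monomialEval_ofReal hnn hlt (multipliable_one_div_one_sub hnn hlt hs),
    secondMoment_eq hP hmn]
  refine ⟨ENNReal.tsum_le_tsum fun α => mul_le_of_le_one_right' ?_, ?_⟩
  · rw [← ENNReal.ofReal_one]
    exact ENNReal.ofReal_le_ofReal (coverProb_le_one hmn _)
  have hexp : ∑' α : ℕ →₀ ℕ, monomialEval (fun k => ENNReal.ofReal (θ * lam P (k + 1) ^ 2)) α ≤
      ENNReal.ofReal (Real.exp (B / c)) := by
    rw [tsum_monomialEval_ofReal hnn' hlt' (multipliable_one_div_one_sub hnn' hlt'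
      (hs.mul_left θ))]
    exact ENNReal.ofReal_le_ofReal (tprod_one_div_one_sub_le hc hnn' hle (hs.mul_left θ) hB)
  rw [ENNReal.ofReal_mul hδ]
  refine le_trans ?_ (add_le_add_right (mul_le_mul_right hexp _) _)
  rw [← ENNReal.tsum_mul_left, ← ENNReal.tsum_add]
  refine ENNReal.tsum_le_tsum fun α => ?_
  have hre : (fun k => ENNReal.ofReal (θ * lam P (k + 1) ^ 2)) =
      fun k => ENNReal.ofReal θ * ENNReal.ofReal (lam P (k + 1) ^ 2) :=
    funext fun k => ENNReal.ofReal_mul hθ0.le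
  set M := monomialEval (fun k => ENNReal.ofReal (lam P (k + 1) ^ 2)) α
  rw [hre, monomialEval_mul_const, ← mul_assoc, ← ENNReal.ofReal_pow hθ0.le,
    ← ENNReal.ofReal_mul hδ, mul_comm M, ← add_mul,
    ← ENNReal.ofReal_add (coverProb_nonneg _ _ _) (by positivity)]
  refine le_mul_of_one_le_left' ?_
  rw [← ENNReal.ofReal_one]
  refine ENNReal.ofReal_le_ofReal ?_
  have hp1 := coverProb_le_one hmn R
  have hpos : 0 < (θ ^ R)⁻¹ := by positivity
  rcases le_or_gt α.degree R with hd | hd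
  · have h1 := coverProb_antitone hmn hd
    have h2 : 1 - coverProb n m R + (θ ^ R)⁻¹ ≤
        (1 - coverProb n m R + (θ ^ R)⁻¹) * θ ^ α.degree :=
      le_mul_of_one_le_right hδ (one_le_pow₀ hθ)
    linarith
  · have h1 := coverProb_nonneg n m α.degree
    have h2 : θ ^ R ≤ θ ^ α.degree := pow_le_pow_right₀ hθ hd.le
    have h3 : 1 ≤ (θ ^ R)⁻¹ * θ ^ α.degree := by
      rw [inv_mul_eq_div, one_le_div (by positivity)]
      exact h2
    have h4 : (θ ^ R)⁻¹ * θ ^ α.degree ≤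
        (1 - coverProb n m R + (θ ^ R)⁻¹) * θ ^ α.degree :=
      mul_le_mul_of_nonneg_right (by linarith) (by positivity)
    linarith

/-- From `gh ≤ (g² + h²)/2`. Boundedness is what makes the real `sSup` in `maximalCorrelation` an
upper bound. -/
theorem bddAbove_correlations (P : Measure (X × Y)) :
    BddAbove {r : ℝ | ∃ (g : X → ℝ) (h : Y → ℝ), Measurable g ∧ Measurable h ∧
      MemLp g 2 P.fst ∧ MemLp h 2 P.snd ∧
      ∫ x, g x ∂P.fst = 0 ∧ ∫ y, h y ∂P.snd = 0 ∧
      ∫ x, g x ^ 2 ∂P.fst = 1 ∧ ∫ y, h y ^ 2 ∂P.snd = 1 ∧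
      r = ∫ p, g p.1 * h p.2 ∂P} := by
  refine ⟨1, ?_⟩
  rintro r ⟨g, h, hgm, hhm, hg, hh, -, -, hg1, hh1, rfl⟩
  have hfst : MeasurePreserving Prod.fst P P.fst := ⟨measurable_fst, rfl⟩
  have hsnd : MeasurePreserving Prod.snd P P.snd := ⟨measurable_snd, rfl⟩
  have hg' : MemLp (fun p : X × Y => g p.1) 2 P := hg.comp_measurePreserving hfst
  have hh' : MemLp (fun p : X × Y => h p.2) 2 P := hh.comp_measurePreserving hsnd
  have h1 : ∫ p, g p.1 ^ 2 ∂P = 1 := by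
    rw [← hg1]
    exact (integral_map measurable_fst.aemeasurable
      (hgm.pow_const 2).aestronglyMeasurable).symm
  have h2 : ∫ p, h p.2 ^ 2 ∂P = 1 := by
    rw [← hh1]
    exact (integral_map measurable_snd.aemeasurable
      (hhm.pow_const 2).aestronglyMeasurable).symm
  have hle : ∫ p, g p.1 * h p.2 ∂P ≤ ∫ p, (g p.1 ^ 2 + h p.2 ^ 2) / 2 ∂P := by
    refine integral_mono (hg'.integrable_mul hh')
      ((hg'.integrable_sq.add hh'.integrable_sq).div_const 2) fun p => ?_
    simp only
    nlinarith [sq_nonneg (g p.1 - h p.2)]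
  refine hle.trans (le_of_eq ?_)
  rw [integral_div, integral_add hg'.integrable_sq hh'.integrable_sq, h1, h2]
  norm_num

/-- The singular functions of index `1` are normalised, have mean zero and correlation `λ_1`, so
they compete in the supremum. The maximum with `0` covers `λ_1 = 0`, where no such pair is supplied.
-/
theorem lam_one_le_max (hP : chiSqInfo P ≠ ∞) : lam P 1 ≤ max 0 (maximalCorrelation P) := by
  by_cases h : lam P 1 = 0
  · rw [h]
    exact le_max_left _ _
  refine le_max_of_le_right ?_
  obtain ⟨-, -, -, -, φ, ψ, hφm, hψm, hφ, hψ, hφφ, hψψ, hφψ, hφo, hψo⟩ := exists_svd hP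
  refine le_csSup (bddAbove_correlations P) ⟨φ ⟨1, h⟩, ψ ⟨1, h⟩, hφm _, hψm _, hφ _, hψ _, ?_, ?_,
    ?_, ?_, ?_⟩
  · rw [hφo]
    simp
  · rw [hψo]
    simp
  · simp_rw [sq]
    rw [hφφ, if_pos rfl]
  · simp_rw [sq]
    rw [hψψ, if_pos rfl]
  · rw [hφψ, if_pos rfl]

theorem altLaw_absolutelyContinuous (hP : chiSqInfo P ≠ ∞) (n m : ℕ) :
    altLaw P n m ≪ nullLaw P n m := by
  rw [altLaw_eq_withDensity (absolutelyContinuous_of_chiSqInfo_ne_top hP)]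
  exact withDensity_absolutelyContinuous _ _

end Bounds

/-! ### From a bounded second moment to impossibility of strong detection -/

section Detection

/-- A bound on the probability of an event by the second moment of the likelihood ratio. -/
theorem measure_le_of_secondMoment_le {Ω : Type*} [MeasurableSpace Ω] {μ ν : Measure Ω}
    [SigmaFinite μ] [SigmaFinite ν] (h : ν ≪ μ) {K M : ℝ≥0∞} (hM0 : M ≠ 0) (hM : M ≠ ∞)
    (hK : ∫⁻ w, ν.rnDeriv μ w ^ 2 ∂μ ≤ K) (A : Set Ω) :
    ν A ≤ M * μ A + K / M := by
  -- Truncation at level `M`: above it, `x ≤ x²/M`.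
  have hpt : ∀ x : ℝ≥0∞, x ≤ M + x ^ 2 / M := by
    intro x
    rcases le_or_gt x M with hx | hx
    · exact hx.trans le_self_add
    · refine le_trans ?_ le_add_self
      rw [ENNReal.le_div_iff_mul_le (Or.inl hM0) (Or.inl hM), sq]
      exact mul_le_mul_right hx.le _
  rw [← Measure.setLIntegral_rnDeriv h]
  calc ∫⁻ w in A, ν.rnDeriv μ w ∂μ ≤ ∫⁻ w in A, (M + ν.rnDeriv μ w ^ 2 / M) ∂μ :=
        lintegral_mono fun w => hpt _
    _ = M * μ A + ∫⁻ w in A, ν.rnDeriv μ w ^ 2 / M ∂μ := by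
        rw [lintegral_add_left measurable_const, setLIntegral_const]
    _ ≤ M * μ A + ∫⁻ w, ν.rnDeriv μ w ^ 2 / M ∂μ := by
        gcongr
        exact Measure.restrict_le_self
    _ ≤ M * μ A + K / M := by
        gcongr
        simp_rw [div_eq_mul_inv]
        rw [lintegral_mul_const _ ((Measure.measurable_rnDeriv _ _).pow_const 2)]
        gcongr

/-- At level `M = 2K` the alternative gives `A` mass at most `2K` times its null mass plus `1/2`.
With both errors vanishing, its total mass would be at most `1/2` in the limit. -/
theorem not_strongDetectionPossible {X : ℕ → Type u} {Y : ℕ → Type v}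
    [∀ n, MeasurableSpace (X n)] [∀ n, MeasurableSpace (Y n)]
    (P : ∀ n, Measure (X n × Y n)) [∀ n, IsProbabilityMeasure (P n)] (m : ℕ → ℕ)
    (hmn : ∀ n, m n ≤ n) {K : ℝ≥0} (hK0 : 0 < K)
    (hac : ∀ᶠ n in atTop, altLaw (P n) n (m n) ≪ nullLaw (P n) n (m n))
    (hK : ∀ᶠ n in atTop, secondMoment (P n) n (m n) ≤ K) : ¬ StrongDetectionPossible P m := by
  rintro ⟨A, hA, h0, h1⟩
  have hK' : (K : ℝ≥0∞) ≠ 0 := by exact_mod_cast hK0.ne'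
  have hlim : Tendsto (fun n => (2 * K : ℝ≥0∞) * nullLaw (P n) n (m n) (A n) + 2⁻¹ +
      altLaw (P n) n (m n) (A n)ᶜ) atTop (𝓝 ((2 * K : ℝ≥0∞) * 0 + 2⁻¹ + 0)) :=
    ((ENNReal.Tendsto.const_mul h0 (Or.inr (ENNReal.mul_ne_top (by simp) (by simp)))).add
      tendsto_const_nhds).add h1
  have hge : ∀ᶠ n in atTop, 1 ≤ (2 * K : ℝ≥0∞) * nullLaw (P n) n (m n) (A n) + 2⁻¹ +
      altLaw (P n) n (m n) (A n)ᶜ := by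
    filter_upwards [hac, hK] with n hacn hKn
    have := isProbabilityMeasure_altLaw (P n) (hmn n)
    have hb := measure_le_of_secondMoment_le hacn (M := 2 * K) (mul_ne_zero (by simp) hK')
      (ENNReal.mul_ne_top (by simp) (by simp)) hKn (A n)
    have hdiv : (K : ℝ≥0∞) / (2 * K) = 2⁻¹ := by
      have := ENNReal.mul_div_mul_right 1 2 hK' ENNReal.coe_ne_top
      rwa [one_mul, one_div] at this
    rw [hdiv] at hb
    rw [← prob_add_prob_compl (μ := altLaw (P n) n (m n)) (hA n)]
    gcongr
  have := ge_of_tendsto hlim hge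
  simp only [mul_zero, zero_add, add_zero] at this
  rw [ENNReal.one_le_inv] at this
  exact absurd this (by norm_num)

end Detection

/-! ### The four claims -/

section MainResults

theorem secondMoment_le_tprod_lam (c : ℝ) (hc0 : 0 < c) (hc1 : c < 1) :
    ∀ (X : Type u) (Y : Type v) [MeasurableSpace X] [MeasurableSpace Y]
      (P : Measure (X × Y)) [IsProbabilityMeasure P] (n m : ℕ),
      chiSqInfo P ≠ ∞ → (m : ℝ) ≤ (1 - c) * n →
        Multipliable (fun k : ℕ => 1 / (1 - (m : ℝ) / n * lam P k ^ 2)) ∧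
        secondMoment P n m ≤
          ENNReal.ofReal (∏' k : ℕ, 1 / (1 - (m : ℝ) / n * lam P k ^ 2)) := by
  intro X Y _ _ P _ n m hP hm
  obtain ⟨hanti, hnn, h0, -⟩ := exists_svd hP
  have hmn : m ≤ n := by
    have : (m : ℝ) ≤ n := hm.trans (by nlinarith [(Nat.cast_nonneg n : (0 : ℝ) ≤ n)])
    exact_mod_cast this
  have ht : (m : ℝ) / n ≤ 1 - c := div_le_of_le_mul₀ (by positivity) (by linarith) hm
  have ht0 : 0 ≤ (m : ℝ) / n := by positivity
  have hlt : ∀ k, (m : ℝ) / n * lam P k ^ 2 < 1 := fun k => by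
    have h1 : lam P k ^ 2 ≤ 1 := pow_le_one₀ (hnn k) (h0 ▸ hanti (Nat.zero_le k))
    nlinarith [sq_nonneg (lam P k)]
  have hs : Summable fun k => (m : ℝ) / n * lam P k ^ 2 :=
    ((summable_nat_add_iff (f := fun k => lam P k ^ 2) 1).1 (summable_lam_succ_sq hP)).mul_left _
  have hmul := multipliable_one_div_one_sub (fun k => by positivity) hlt hs
  have hmul' := multipliable_one_div_one_sub
    (w := fun k => (m : ℝ) / n * lam P (k + 1) ^ 2) (fun k => by positivity)
    (fun k => hlt (k + 1)) ((summable_lam_succ_sq hP).mul_left _)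
  refine ⟨hmul, (secondMoment_le_tprod hP hmn fun k => hlt (k + 1)).trans
    (ENNReal.ofReal_le_ofReal ?_)⟩
  -- The bound already holds for the product over `k ≥ 1`; the factor at `k = 0` is at least `1` and
  -- only weakens it.
  rw [tprod_eq_zero_mul' (f := fun k => 1 / (1 - (m : ℝ) / n * lam P k ^ 2)) hmul']
  refine le_mul_of_one_le_left ?_ ?_
  · exact tprod_one_div_one_sub_nonneg (w := fun k => (m : ℝ) / n * lam P (k + 1) ^ 2)
      (fun k => by positivity) (fun k => hlt (k + 1)) ((summable_lam_succ_sq hP).mul_left _)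
  · rw [le_div_iff₀ (by linarith [hlt 0])]
    have : 0 ≤ (m : ℝ) / n * lam P 0 ^ 2 := by positivity
    linarith

theorem tendsto_secondMoment_sub_tprod_lam (c₁ C : ℝ) (hd0 : 0 < c₁) (hd1 : c₁ < 1) (hC : 0 < C) :
    ∀ (X : ℕ → Type u) (Y : ℕ → Type v)
      [∀ n, MeasurableSpace (X n)] [∀ n, MeasurableSpace (Y n)]
      (P : ∀ n, Measure (X n × Y n)) [∀ n, IsProbabilityMeasure (P n)]
      (m : ℕ → ℕ), (∀ n, m n ≤ n) →
      (∀ᶠ n in atTop, chiSqInfo (P n) ≠ ∞) →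
      Tendsto (fun n => (m n : ℝ) / n) atTop (𝓝 1) →
      (∀ᶠ n in atTop, lam (P n) 1 ≤ 1 - c₁) →
      (∀ᶠ n in atTop, ∑' k : ℕ, ENNReal.ofReal (lam (P n) (k + 1) ^ 2) ≤ ENNReal.ofReal C) →
        (∀ᶠ n in atTop, secondMoment (P n) n (m n) ≠ ∞ ∧
          Multipliable (fun k : ℕ => 1 / (1 - lam (P n) (k + 1) ^ 2))) ∧
        Tendsto (fun n => |(secondMoment (P n) n (m n)).toReal -
          ∏' k : ℕ, 1 / (1 - lam (P n) (k + 1) ^ 2)|) atTop (𝓝 0) := by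
  intro X Y _ _ P _ m hmn hfin hlim hlam hsum
  -- With this choice `θ λ_k² ≤ θ (1 - c₁)² = 1 - c₁`, so the enlarged variables keep a gap `c₁`
  -- below `1`.
  set θ : ℝ := 1 / (1 - c₁) with hθ
  have hθ1 : 1 ≤ θ := by
    rw [hθ, le_div_iff₀ (by linarith)]
    linarith
  have hθ1' : 1 < θ := by
    rw [hθ, lt_div_iff₀ (by linarith)]
    linarith
  have hle : ∀ᶠ n in atTop, ∀ k, θ * lam (P n) (k + 1) ^ 2 ≤ 1 - c₁ := by
    filter_upwards [hfin, hlam] with n h1 h2 k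
    have := lam_succ_sq_le h1 h2 k
    rw [hθ, div_mul_eq_mul_div, one_mul, div_le_iff₀ (by linarith)]
    nlinarith
  have hB : ∀ᶠ n in atTop, ∑' k, θ * lam (P n) (k + 1) ^ 2 ≤ θ * C := by
    filter_upwards [hfin, hsum] with n h1 h2
    rw [tsum_mul_left]
    refine mul_le_mul_of_nonneg_left ?_ (by linarith)
    rw [tsum_lam_succ_sq h1, ← ofReal_tsum_lam_succ_sq h1] at h2
    exact (ENNReal.ofReal_le_ofReal_iff hC.le).1 h2
  have hbound : ∀ R, ∀ᶠ n in atTop, |(secondMoment (P n) n (m n)).toReal -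
      ∏' k : ℕ, 1 / (1 - lam (P n) (k + 1) ^ 2)| ≤
      (1 - coverProb n (m n) R + (θ ^ R)⁻¹) * Real.exp (θ * C / c₁) := by
    intro R
    filter_upwards [hfin, hle, hB] with n h1 h2 h3
    obtain ⟨hlo, hhi⟩ := tprod_le_secondMoment_add h1 (hmn n) hθ1 hd0 h2 h3 R
    have hδ : 0 ≤ (1 - coverProb n (m n) R + (θ ^ R)⁻¹) * Real.exp (θ * C / c₁) := by
      have := coverProb_le_one (hmn n) R
      have : 0 < (θ ^ R)⁻¹ := by positivity
      exact mul_nonneg (by linarith) (Real.exp_nonneg _)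
    have hprod : 0 ≤ ∏' k : ℕ, 1 / (1 - lam (P n) (k + 1) ^ 2) := by
      refine tprod_one_div_one_sub_nonneg (fun k => sq_nonneg _) (fun k => ?_)
        (summable_lam_succ_sq h1)
      have h4 : 0 ≤ lam (P n) (k + 1) ^ 2 := sq_nonneg _
      nlinarith [h2 k]
    have hne : secondMoment (P n) n (m n) ≠ ∞ := ne_top_of_le_ne_top ENNReal.ofReal_ne_top hlo
    have hlo' := ENNReal.toReal_mono ENNReal.ofReal_ne_top hlo
    rw [ENNReal.toReal_ofReal hprod] at hlo'
    have hhi' := ENNReal.toReal_mono (ENNReal.add_ne_top.2 ⟨hne, ENNReal.ofReal_ne_top⟩) hhi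
    rw [ENNReal.toReal_ofReal hprod, ENNReal.toReal_add hne ENNReal.ofReal_ne_top,
      ENNReal.toReal_ofReal hδ] at hhi'
    rw [abs_le]
    constructor <;> linarith
  refine ⟨?_, ?_⟩
  · filter_upwards [hfin, hle, hB] with n h1 h2 h3
    refine ⟨ne_top_of_le_ne_top ENNReal.ofReal_ne_top
      (tprod_le_secondMoment_add h1 (hmn n) hθ1 hd0 h2 h3 0).1, ?_⟩
    refine multipliable_one_div_one_sub (fun k => sq_nonneg _) (fun k => ?_)
      (summable_lam_succ_sq h1)
    have h4 : 0 ≤ lam (P n) (k + 1) ^ 2 := sq_nonneg _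
    nlinarith [h2 k]
  · rw [Metric.tendsto_atTop']
    intro ε hε
    set K := Real.exp (θ * C / c₁) with hK
    have hKpos : 0 < K := Real.exp_pos _
    -- The degree cutoff `R` is fixed first, uniformly in `n`; only then is `n` taken large for the
    -- cover probability of degree `R`.
    obtain ⟨R, hR⟩ : ∃ R : ℕ, (θ ^ R)⁻¹ * K < ε / 2 := by
      have := (tendsto_pow_atTop_nhds_zero_of_lt_one (inv_nonneg.2 (by linarith))
        (inv_lt_one_of_one_lt₀ hθ1')).mul_const K
      rw [zero_mul] at this
      obtain ⟨R, hR⟩ := (this.eventually_lt_const (half_pos hε)).exists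
      exact ⟨R, by rwa [inv_pow] at hR⟩
    have hcov : ∀ᶠ n in atTop, (1 - coverProb n (m n) R) * K < ε / 2 := by
      have := (tendsto_const_nhds (x := (1 : ℝ))).sub (tendsto_coverProb hlim R)
      have := this.mul_const K
      rw [sub_self, zero_mul] at this
      exact this.eventually_lt_const (half_pos hε)
    obtain ⟨N, hN⟩ := eventually_atTop.1 ((hbound R).and hcov)
    refine ⟨N, fun n hn => ?_⟩
    obtain ⟨h1, h2⟩ := hN n hn.le
    rw [Real.dist_eq, sub_zero, abs_abs]
    rw [add_mul] at h1
    linarith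

theorem secondMoment_bounded_of_le_mul (c C : ℝ) (hc0 : 0 < c) (hc1 : c < 1) (hC : 0 < C) :
    ∃ K : ℝ≥0, ∀ (X : ℕ → Type u) (Y : ℕ → Type v)
      [∀ n, MeasurableSpace (X n)] [∀ n, MeasurableSpace (Y n)]
      (P : ∀ n, Measure (X n × Y n)) [∀ n, IsProbabilityMeasure (P n)]
      (m : ℕ → ℕ), (∀ n, m n ≤ n) →
      (∀ᶠ n in atTop, (m n : ℝ) ≤ (1 - c) * n) →
      (∀ᶠ n in atTop, chiSqInfo (P n) ≤ ENNReal.ofReal C * ((n : ℝ≥0∞) / (m n : ℝ≥0∞))) →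
        (∀ᶠ n in atTop, secondMoment (P n) n (m n) ≤ K) ∧
        ¬ StrongDetectionPossible P m := by
  refine ⟨(Real.exp (C / c)).toNNReal, fun X Y _ _ P _ m hmn hm hchi => ?_⟩
  have hK : ((Real.exp (C / c)).toNNReal : ℝ≥0∞) = ENNReal.ofReal (Real.exp (C / c)) := rfl
  have hfin : ∀ n, m n ≠ 0 →
      chiSqInfo (P n) ≤ ENNReal.ofReal C * ((n : ℝ≥0∞) / (m n : ℝ≥0∞)) →
      chiSqInfo (P n) ≠ ∞ := fun n h0 h => ne_top_of_le_ne_top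
    (ENNReal.mul_ne_top ENNReal.ofReal_ne_top (ENNReal.div_ne_top (by simp)
      (by exact_mod_cast h0))) h
  have hb : ∀ᶠ n in atTop, secondMoment (P n) n (m n) ≤ (Real.exp (C / c)).toNNReal := by
    filter_upwards [hm, hchi] with n h1 h2
    rw [hK]
    rcases eq_or_ne (m n) 0 with h0 | h0
    · rw [h0, secondMoment_zero, ← ENNReal.ofReal_one]
      exact ENNReal.ofReal_le_ofReal (Real.one_le_exp (by positivity))
    have hP := hfin n h0 h2
    have hn0 : n ≠ 0 := fun h => h0 (Nat.le_zero.1 (h ▸ hmn n))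
    refine secondMoment_le_exp hP (hmn n) hc0 (fun k => ?_) ?_ hC.le
    · have ht : (m n : ℝ) / n ≤ 1 - c := div_le_of_le_mul₀ (by positivity) (by linarith) h1
      have ht0 : 0 ≤ (m n : ℝ) / n := by positivity
      have := lam_succ_sq_le_one hP k
      exact (mul_le_of_le_one_right ht0 this).trans ht
    · have hnpos : (0 : ℝ) < n := by exact_mod_cast Nat.pos_of_ne_zero hn0
      -- The factor `m/n` cancels the `n/m` of the hypothesis, so the variables `(m/n) λ_k²` sum to
      -- at most `C`.
      refine (mul_le_mul_right h2 _).trans (le_of_eq ?_)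
      rw [ENNReal.ofReal_div_of_pos hnpos, ENNReal.ofReal_natCast, ENNReal.ofReal_natCast,
        mul_left_comm, ← mul_div_assoc, ENNReal.div_mul_cancel (by exact_mod_cast hn0) (by simp),
        ENNReal.div_self (by exact_mod_cast h0) (by simp), mul_one]
  refine ⟨hb, not_strongDetectionPossible P m hmn (by simpa using Real.exp_pos _) ?_ hb⟩
  filter_upwards [hchi] with n h2
  rcases eq_or_ne (m n) 0 with h0 | h0
  · rw [h0, altLaw_zero]
  · exact altLaw_absolutelyContinuous (hfin n h0 h2) _ _

theorem secondMoment_bounded_of_maximalCorrelation_le (c₁ C : ℝ) (hd0 : 0 < c₁) (hd1 : c₁ < 1) (hC : 0 < C) :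
    ∃ K : ℝ≥0, ∀ (X : ℕ → Type u) (Y : ℕ → Type v)
      [∀ n, MeasurableSpace (X n)] [∀ n, MeasurableSpace (Y n)]
      (P : ∀ n, Measure (X n × Y n)) [∀ n, IsProbabilityMeasure (P n)]
      (m : ℕ → ℕ), (∀ n, m n ≤ n) →
      Tendsto (fun n => (m n : ℝ) / n) atTop (𝓝 1) →
      (∀ᶠ n in atTop, maximalCorrelation (P n) ≤ 1 - c₁) →
      (∀ᶠ n in atTop, chiSqInfo (P n) ≤ ENNReal.ofReal C) →
        (∀ᶠ n in atTop, secondMoment (P n) n (m n) ≤ K) ∧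
        ¬ StrongDetectionPossible P m := by
  refine ⟨(Real.exp (C / c₁)).toNNReal, fun X Y _ _ P _ m hmn _ hρ hchi => ?_⟩
  have hK : ((Real.exp (C / c₁)).toNNReal : ℝ≥0∞) = ENNReal.ofReal (Real.exp (C / c₁)) := rfl
  have hb : ∀ᶠ n in atTop, secondMoment (P n) n (m n) ≤ (Real.exp (C / c₁)).toNNReal := by
    filter_upwards [hρ, hchi] with n h1 h2
    have hP : chiSqInfo (P n) ≠ ∞ := ne_top_of_le_ne_top ENNReal.ofReal_ne_top h2
    have ht0 : 0 ≤ (m n : ℝ) / n := by positivity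
    have ht1 : (m n : ℝ) / n ≤ 1 :=
      div_le_one_of_le₀ (by exact_mod_cast hmn n) (by positivity)
    rw [hK]
    refine secondMoment_le_exp hP (hmn n) hd0 (fun k => ?_) ?_ hC.le
    -- Here the gap comes from the correlation: `(m/n) λ_k² ≤ (1 - c₁)² ≤ 1 - c₁`.
    · have h3 : lam (P n) 1 ≤ 1 - c₁ :=
        (lam_one_le_max hP).trans (max_le (by linarith) h1)
      have h4 := lam_succ_sq_le hP h3 k
      have h5 := mul_le_of_le_one_left (sq_nonneg (lam (P n) (k + 1))) ht1
      nlinarith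
    · refine (mul_le_of_le_one_left' ?_).trans h2
      rw [← ENNReal.ofReal_one]
      exact ENNReal.ofReal_le_ofReal ht1
  refine ⟨hb, not_strongDetectionPossible P m hmn (by simpa using Real.exp_pos _) ?_ hb⟩
  filter_upwards [hchi] with n h2
  exact altLaw_absolutelyContinuous (ne_top_of_le_ne_top ENNReal.ofReal_ne_top h2) _ _

end MainResults

end BrokenSample

open BrokenSample

theorem mainTheorem3 (c c₁ C : ℝ) (hc : c ∈ Ioo (0 : ℝ) 1) (hc₁ : c₁ ∈ Ioo (0 : ℝ) 1)
    (hC : 0 < C) :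
    -- Upper bound on the second moment for `m ≤ (1 - c) n`
    (∀ (X : Type u) (Y : Type v) [MeasurableSpace X] [MeasurableSpace Y]
      (P : Measure (X × Y)) [IsProbabilityMeasure P] (n m : ℕ),
      chiSqInfo P ≠ ∞ → (m : ℝ) ≤ (1 - c) * n →
        Multipliable (fun k : ℕ => 1 / (1 - (m : ℝ) / n * lam P k ^ 2)) ∧
        secondMoment P n m ≤
          ENNReal.ofReal (∏' k : ℕ, 1 / (1 - (m : ℝ) / n * lam P k ^ 2))) ∧
    -- Limit of the second moment for `m = (1 - o(1)) n`
    (∀ (X : ℕ → Type u) (Y : ℕ → Type v)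
      [∀ n, MeasurableSpace (X n)] [∀ n, MeasurableSpace (Y n)]
      (P : ∀ n, Measure (X n × Y n)) [∀ n, IsProbabilityMeasure (P n)]
      (m : ℕ → ℕ), (∀ n, m n ≤ n) →
      (∀ᶠ n in atTop, chiSqInfo (P n) ≠ ∞) →
      Tendsto (fun n => (m n : ℝ) / n) atTop (𝓝 1) →
      (∀ᶠ n in atTop, lam (P n) 1 ≤ 1 - c₁) →
      (∀ᶠ n in atTop, ∑' k : ℕ, ENNReal.ofReal (lam (P n) (k + 1) ^ 2) ≤ ENNReal.ofReal C) →
        (∀ᶠ n in atTop, secondMoment (P n) n (m n) ≠ ∞ ∧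
          Multipliable (fun k : ℕ => 1 / (1 - lam (P n) (k + 1) ^ 2))) ∧
        Tendsto (fun n => |(secondMoment (P n) n (m n)).toReal -
          ∏' k : ℕ, 1 / (1 - lam (P n) (k + 1) ^ 2)|) atTop (𝓝 0)) ∧
    -- Impossibility of strong detection for `m ≤ (1 - c) n`
    (∃ K : ℝ≥0, ∀ (X : ℕ → Type u) (Y : ℕ → Type v)
      [∀ n, MeasurableSpace (X n)] [∀ n, MeasurableSpace (Y n)]
      (P : ∀ n, Measure (X n × Y n)) [∀ n, IsProbabilityMeasure (P n)]
      (m : ℕ → ℕ), (∀ n, m n ≤ n) →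
      (∀ᶠ n in atTop, (m n : ℝ) ≤ (1 - c) * n) →
      (∀ᶠ n in atTop, chiSqInfo (P n) ≤ ENNReal.ofReal C * ((n : ℝ≥0∞) / (m n : ℝ≥0∞))) →
        (∀ᶠ n in atTop, secondMoment (P n) n (m n) ≤ K) ∧
        ¬ StrongDetectionPossible P m) ∧
    -- Impossibility of strong detection for `m = (1 - o(1)) n`
    (∃ K : ℝ≥0, ∀ (X : ℕ → Type u) (Y : ℕ → Type v)
      [∀ n, MeasurableSpace (X n)] [∀ n, MeasurableSpace (Y n)]
      (P : ∀ n, Measure (X n × Y n)) [∀ n, IsProbabilityMeasure (P n)]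
      (m : ℕ → ℕ), (∀ n, m n ≤ n) →
      Tendsto (fun n => (m n : ℝ) / n) atTop (𝓝 1) →
      (∀ᶠ n in atTop, maximalCorrelation (P n) ≤ 1 - c₁) →
      (∀ᶠ n in atTop, chiSqInfo (P n) ≤ ENNReal.ofReal C) →
        (∀ᶠ n in atTop, secondMoment (P n) n (m n) ≤ K) ∧
        ¬ StrongDetectionPossible P m) := by
  exact ⟨secondMoment_le_tprod_lam c hc.1 hc.2,
    tendsto_secondMoment_sub_tprod_lam c₁ C hc₁.1 hc₁.2 hC,
    secondMoment_bounded_of_le_mul c C hc.1 hc.2 hC,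
    secondMoment_bounded_of_maximalCorrelation_le c₁ C hc₁.1 hc₁.2 hC⟩
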